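/- Let $F$ be a field and $\alpha,\beta,\gamma\in F$ (for instance indeterminates in $F=\mathbb{C}(\alpha,\beta,\gamma)$), and let $n\ge 1$. **Operators.** On $F[x_1,\dots,x_n]$ let $\partial_i f=\dfrac{f(\dots,x_{i+1},x_i,\dots)-f}{x_{i+1}-x_i}$ and $$T_i=-\beta+\big((\alpha+\beta+\gamma)x_i+\gamma x_{i+1}+1+(\beta+\gamma)(\alpha+\gamma)x_ix_{i+1}\big)\partial_i\qquad(1\le i\le n-1).$$ For $w\in S_n$ with reduced word $w=s_{i_1}\cdots s_{i_\ell}$ put $T_w=T_{i_1}\cdots T_{i_\ell}$. For a weak composition $\zeta=(\zeta_1,\dots,\zeta_n)$ let $\zeta^+$ be its weakly decreasing rearrangement, let $v_\zeta\in S_n$ be the permutation of minimal length with $\zeta_{v_\zeta(i)}=\zeta^+_i$ for all $i$, and let $K_\zeta^{(\beta,\alpha,\gamma)}(\boldsymbol x)=T_{v_\zeta}(\boldsymbol x^{\zeta^+})$. For a partition $\lambda=(\lambda_1\ge\dots\ge\lambda_n)$ let $\mathcal{KN}_w^{(\beta,\alpha,\gamma)}(\boldsymbol x;\lambda)=T_w(\boldsymbol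 x^{d})$ with $d_i=\lambda_1-\lambda_{n+1-i}+n-i$. **Lattice model.** Let $h_k=\sum_{i=0}^k\alpha^i\beta^{k-i}$ for $k\ge0$, $h_{-1}=0$, and read $\alpha\beta h_{-2}$ as $-1$. A grid has rows $1,\dots,n$ from top to bottom and columns $N,\dots,1,0$ from left to right. Horizontal edges are labeled by elements of $\{+,1,\dots,n\}$, vertical edges by subsets of $\{1,\dots,n\}$. For a set $\Sigma$ of colors put $\Sigma_{>c}=\{s\in\Sigma:s>c\}$. A vertex in row $i$ with labels (left, top, right, bottom) has, with $x=x_i$, $A=1+(\alpha+\gamma)x$ and $B=1+(\beta+\gamma)x$, the weight * $(+,\Sigma,+,\Sigma)$: $(-1)^{|\Sigma|+1}\big(((\alpha+\gamma)(\beta+\gamma)x+\gamma)h_{|\Sigma|-1}+\alpha\beta h_{|\Sigma|-2}\big)$; * $(c,\Sigma,c,\Sigma)$: $(1+(\alpha+\beta+\gamma)x)(\alpha\beta)^{|\Sigma_{>c}|}$ if $c\in\Sigma$, and $x(\alpha\beta)^{|\Sigma_{>c}|}$ if $c\notin\Sigma$; * $(+,\Sigma,c,\Sigma\cup\{c\})$,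 $c\notin\Sigma$: $(-\alpha)^{|\Sigma_{>c}|}AB$; * $(c,\Sigma,+,\Sigma\setminus\{c\})$, $c\in\Sigma$: $(-1)^{|\Sigma|}(-\beta)^{|\Sigma_{>c}|}(\alpha\beta h_{|\Sigma|-3}+\gamma h_{|\Sigma|-2})$; * $(c,\Sigma,d,\Sigma')$, $c\in\Sigma$, $d\notin\Sigma$, $\Sigma'=(\Sigma\cup\{d\})\setminus\{c\}$: $(-\alpha)^{|\Sigma_{>d}|}(-\beta)^{|\Sigma_{>c}|}A$ if $c<d$, and $(-\alpha)^{|\Sigma'_{>d}|}(-\beta)^{|\Sigma_{>c}|}B$ if $d<c$; and weight $0$ for all other labelings. Let $w_0(i)=n+1-i$, $\rho=(n-1,\dots,1,0)$ and $\mu_i=\zeta_1^+-\zeta_{n+1-i}^+$. Let $\mathfrak{S}_{v_\zeta}^{\mu-\rho}$ be the system with $n$ rows and $\zeta_1^++1$ columns whose boundary is given by $w_1=v_\zeta$, $w_2=w_0$ and $\mu$: the left edge of row $i$ is labeled $n+1-w_1^{-1}(i)$, the top edge of column $m$ is labeled $\{n+1-w_2^{-1}(i):\mu_i=m\}$, the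 right edges are labeled $+$ and the bottom edges $\varnothing$. Let $Z(\mathfrak{S}_{v_\zeta}^{\mu-\rho})$ be the sum, over all labelings of the edges with this boundary, of the product of the weights of all vertices. Let $$C=\prod_{p}\prod_{j=1}^{n_p}(-1)^{j-1}\big(-\alpha\beta h_{j-3}-\gamma h_{j-2}\big),$$ where $p$ runs over the distinct parts of $\mu$ and $n_p$ is the multiplicity of $p$. **Theorem 4.1 (generalized key polynomials as partition functions).** The permutation $v_\zeta$ is unique, $T_{v_\zeta}(\boldsymbol x^{\zeta^+})$ does not depend on the reduced word, and $$C\cdot K_\zeta^{(\beta,\alpha,\gamma)}(\boldsymbol x)=Z(\mathfrak{S}_{v_\zeta}^{\mu-\rho}).$$ Hence $K_\zeta^{(\beta,\alpha,\gamma)}(\boldsymbol x)=\frac1C\,Z(\mathfrak{S}_{v_\zeta}^{\mu-\rho})$ whenever $C\ne0$, and $C\neq0$ if $\alpha,\beta,\gamma$ are algebraically independent over $\mathbb Z$. **Corollary.** If $\lambda=\mu-\rho$ is a partition, then $\mathcal{KN}_{v_\zeta}^{(\beta,\alpha,\gamma)}(\boldsymbol x;\lambda)=T_{v_\zeta}(\boldsymbol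 x^{d})$ does not depend on the reduced word and $$K_\zeta^{(\beta,\alpha,\gamma)}(\boldsymbol x)=(x_1\cdots x_n)^{\zeta_n^+}\,\mathcal{KN}_{v_\zeta}^{(\beta,\alpha,\gamma)}(\boldsymbol x;\lambda);$$ in particular $K_\zeta^{(\beta,\alpha,\gamma)}(\boldsymbol x)=\mathcal{KN}_{v_\zeta}^{(\beta,\alpha,\gamma)}(\boldsymbol x;\lambda)$ if $\zeta_n^+=0$. -/

import Mathlib

namespace KeyLattice

section Words

variable {n : ℕ}

/-- For `i = 0, …, n - 2` (`i + 1` when counting from one), the lower of the two positions of the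
`i`-th simple transposition. -/
def lo (i : Fin (n - 1)) : Fin n := ⟨i.1, by omega⟩

/-- The position following `lo i`. -/
def hi (i : Fin (n - 1)) : Fin n := ⟨i.1 + 1, by omega⟩

/-- The simple transposition exchanging the adjacent positions `lo i` and `hi i`. -/
def simple (i : Fin (n - 1)) : Equiv.Perm (Fin n) := Equiv.swap (lo i) (hi i)

/-- The permutation `s_{i_1} s_{i_2} ⋯ s_{i_ℓ}` (composition of functions) of a word. -/
def wordPerm (ω : List (Fin (n - 1))) : Equiv.Perm (Fin n) := (ω.map simple).prod

/-- A word is reduced if no shorter word represents the same permutation. -/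
def IsReduced (ω : List (Fin (n - 1))) : Prop :=
  ∀ ω' : List (Fin (n - 1)), wordPerm ω' = wordPerm ω → ω.length ≤ ω'.length

theorem exists_word (w : Equiv.Perm (Fin n)) :
    ∃ ω : List (Fin (n - 1)), wordPerm ω = w := by
  cases n with
  | zero => exact ⟨[], Subsingleton.elim _ _⟩
  | succ m =>
    have hw : w ∈ Submonoid.closure
        (Set.range fun i : Fin m ↦ Equiv.swap i.castSucc i.succ) := by
      rw [Equiv.Perm.mclosure_swap_castSucc_succ]; exact Submonoid.mem_top w
    obtain ⟨l, hl, rfl⟩ := Submonoid.exists_list_of_mem_closure hw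
    clear hw
    induction l with
    | nil => exact ⟨[], rfl⟩
    | cons a l ih =>
      obtain ⟨ω, hω⟩ := ih (fun y hy => hl y (List.mem_cons_of_mem _ hy))
      obtain ⟨i, hi⟩ := hl a List.mem_cons_self
      refine ⟨i :: ω, ?_⟩
      have hs : simple (n := m + 1) i = a := by rw [← hi]; rfl
      rw [List.prod_cons, ← hω, ← hs]
      simp [wordPerm]

theorem exists_reduced (w : Equiv.Perm (Fin n)) :
    ∃ ω : List (Fin (n - 1)), wordPerm ω = w ∧ IsReduced ω := by
  classical
  have h : ∃ k, ∃ ω : List (Fin (n - 1)), wordPerm ω = w ∧ ω.length = k := by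
    obtain ⟨ω, hω⟩ := exists_word w
    exact ⟨_, ω, hω, rfl⟩
  obtain ⟨ω, hω, hk⟩ := Nat.find_spec h
  refine ⟨ω, hω, fun ω' hω' => ?_⟩
  rw [hk]
  exact Nat.find_min' h ⟨ω', hω'.trans hω, rfl⟩

/-- A reduced word of `w`. -/
noncomputable def redWord (w : Equiv.Perm (Fin n)) : List (Fin (n - 1)) :=
  (exists_reduced w).choose

/-- The length of a permutation: the number of letters of its reduced words. -/
noncomputable def len (w : Equiv.Perm (Fin n)) : ℕ := (redWord w).length

end Words

section Compositions

variable {n : ℕ}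

/-- The weakly decreasing rearrangement `ζ⁺` of a weak composition `ζ`. -/
def plus (ζ : Fin n → ℕ) : Fin n → ℕ := ζ ∘ Tuple.sort (OrderDual.toDual ∘ ζ)

theorem plus_antitone (ζ : Fin n → ℕ) : Antitone (plus ζ) :=
  fun _ _ h => Tuple.monotone_sort (OrderDual.toDual ∘ ζ) h

/-- `v` has minimal length among the permutations with `v · ζ = ζ⁺`, where
`(v · ζ)_i = ζ_{v(i)}`; these permutations form a left coset of the stabilizer of `ζ⁺`. -/
def IsMinSorter (ζ : Fin n → ℕ) (v : Equiv.Perm (Fin n)) : Prop :=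
  (∀ i, ζ (v i) = plus ζ i) ∧
    ∀ u : Equiv.Perm (Fin n), (∀ i, ζ (u i) = plus ζ i) → len v ≤ len u

theorem exists_minSorter (ζ : Fin n → ℕ) : ∃ v, IsMinSorter ζ v := by
  classical
  have h : ∃ k, ∃ v : Equiv.Perm (Fin n), (∀ i, ζ (v i) = plus ζ i) ∧ len v = k :=
    ⟨_, Tuple.sort (OrderDual.toDual ∘ ζ), fun _ => rfl, rfl⟩
  obtain ⟨v, hv, hk⟩ := Nat.find_spec h
  exact ⟨v, hv, fun u hu => hk ▸ Nat.find_min' h ⟨u, hu, rfl⟩⟩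

/-- The permutation `v_ζ`. -/
noncomputable def vPerm (ζ : Fin n → ℕ) : Equiv.Perm (Fin n) := (exists_minSorter ζ).choose

/-- The sequence `μ_i = ζ⁺_1 - ζ⁺_{n+1-i}`; no truncation occurs, as `ζ⁺` is decreasing. -/
def muOf [NeZero n] (ζ : Fin n → ℕ) (i : Fin n) : ℕ := plus ζ 0 - plus ζ i.rev

/-- `ρ = (n - 1, n - 2, …, 1, 0)`. -/
def rho (i : Fin n) : ℕ := n - 1 - i.1

end Compositions

section Operators

open MvPolynomial

variable {F : Type*} [Field F] {n : ℕ}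

theorem sub_dvd (i : Fin (n - 1)) (f : MvPolynomial (Fin n) F) :
    (X (hi i) - X (lo i) : MvPolynomial (Fin n) F) ∣ rename (simple i) f - f := by
  induction f using MvPolynomial.induction_on with
  | C a => simp
  | add p q hp hq =>
    have : rename (simple i) (p + q) - (p + q)
        = (rename (simple i) p - p) + (rename (simple i) q - q) := by
      rw [map_add]; ring
    rw [this]; exact dvd_add hp hq
  | mul_X p j hp =>
    have hX : (X (hi i) - X (lo i) : MvPolynomial (Fin n) F) ∣ X (simple i j) - X j := by
      unfold simple
      by_cases h1 : j = lo i
      · subst h1; simp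
      · by_cases h2 : j = hi i
        · subst h2
          rw [Equiv.swap_apply_right, ← neg_sub (X (hi i)) (X (lo i)), dvd_neg]
        · rw [Equiv.swap_apply_of_ne_of_ne h1 h2]; simp
    have : rename (simple i) (p * X j) - p * X j
        = (rename (simple i) p - p) * X (simple i j) + p * (X (simple i j) - X j) := by
      rw [map_mul, rename_X]; ring
    rw [this]
    exact dvd_add (hp.mul_right _) (hX.mul_left _)

/-- The divided difference `∂_i f`: the polynomial quotient of
`f(…, x_{i+1}, x_i, …) - f(…, x_i, x_{i+1}, …)` by `x_{i+1} - x_i`. -/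
noncomputable def divDiff (i : Fin (n - 1)) (f : MvPolynomial (Fin n) F) :
    MvPolynomial (Fin n) F := (sub_dvd i f).choose

theorem divDiff_spec (i : Fin (n - 1)) (f : MvPolynomial (Fin n) F) :
    (X (hi i) - X (lo i)) * divDiff i f = rename (simple i) f - f :=
  (sub_dvd i f).choose_spec.symm

/-- Kirillov's operator `T_i^{(β, α, γ)}`. -/
noncomputable def kirOp (α β γ : F) (i : Fin (n - 1)) (f : MvPolynomial (Fin n) F) :
    MvPolynomial (Fin n) F :=
  -(C β) * f + (C (α + β + γ) * X (lo i) + C γ * X (hi i) + 1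
    + C ((β + γ) * (α + γ)) * X (lo i) * X (hi i)) * divDiff i f

/-- `T_{i_1} ∘ T_{i_2} ∘ ⋯ ∘ T_{i_ℓ}` applied to `f`. -/
noncomputable def wordOp (α β γ : F) (ω : List (Fin (n - 1))) (f : MvPolynomial (Fin n) F) :
    MvPolynomial (Fin n) F := ω.foldr (kirOp α β γ) f

/-- The operator `T_w^{(β, α, γ)}`, computed along a reduced word of `w`. -/
noncomputable def permOp (α β γ : F) (w : Equiv.Perm (Fin n)) (f : MvPolynomial (Fin n) F) :
    MvPolynomial (Fin n) F := wordOp α β γ (redWord w) f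

/-- The monomial `x^d`. -/
noncomputable def xPow (F : Type*) [Field F] {n : ℕ} (d : Fin n → ℕ) : MvPolynomial (Fin n) F :=
  ∏ i, X i ^ d i

/-- The generalized key polynomial `K_ζ^{(β, α, γ)}`. -/
noncomputable def keyPoly (α β γ : F) (ζ : Fin n → ℕ) : MvPolynomial (Fin n) F :=
  permOp α β γ (vPerm ζ) (xPow F (plus ζ))

/-- The exponents `d_i = lam_1 - lam_{n+1-i} + n - i` attached to a partition `lam`. -/
def knExp [NeZero n] (lam : Fin n → ℕ) (i : Fin n) : ℕ := lam 0 - lam i.rev + rho i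

/-- The twisted Kirillov polynomial `KN_w^{(β, α, γ)}(x; lam)`. -/
noncomputable def knPoly [NeZero n] (α β γ : F) (w : Equiv.Perm (Fin n)) (lam : Fin n → ℕ) :
    MvPolynomial (Fin n) F := permOp α β γ w (xPow F (knExp lam))

end Operators

section Lattice

variable {A : Type*} [CommRing A] {n : ℕ}

/-- The complete homogeneous symmetric function `h_k(α, β)`, which is `0` for `k = -1`
(the value at `k = -2` is only used through `abh`). -/
def hsym (α β : A) (k : ℤ) : A :=
  if 0 ≤ k then ∑ i ∈ Finset.range (k.toNat + 1), α ^ i * β ^ (k.toNat - i) else 0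

/-- The product `α β h_k(α, β)`, where `h_{-2} = -1 / (α β)`. -/
def abh (α β : A) (k : ℤ) : A := if k = -2 then -1 else α * β * hsym α β k

/-- `x ⊕_{p, γ} 1 = 1 + (p + γ) x`. -/
def oplusOne (p γ x : A) : A := 1 + (p + γ) * x

/-- The number of elements of `S` greater than `c`. -/
def above (c : Fin n) (S : Finset (Fin n)) : ℕ := (S.filter (fun s => c < s)).card

/-- The Boltzmann weight of a vertex with spectral parameter `x`. The edge labels are given in
the order left, top, right, bottom. A horizontal label is a color or the label `+` (`none`),
a vertical label is a set of colors. The color `c : Fin n` is the color `c + 1` when counting from one. -/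
def weight (α β γ x : A) :
    Option (Fin n) → Finset (Fin n) → Option (Fin n) → Finset (Fin n) → A
  | none, S, none, B =>
    if B = S then
      (-1) ^ (S.card + 1) * (((α + γ) * (β + γ) * x + γ) * hsym α β ((S.card : ℤ) - 1)
        + abh α β ((S.card : ℤ) - 2))
    else 0
  | none, S, some c, B =>
    if c ∉ S ∧ B = insert c S then
      (-α) ^ above c S * oplusOne α γ x * oplusOne β γ x
    else 0
  | some c, S, none, B =>
    if c ∈ S ∧ B = S.erase c then
      (-1) ^ S.card * (-β) ^ above c S
        * (abh α β ((S.card : ℤ) - 3) + γ * hsym α β ((S.card : ℤ) - 2))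
    else 0
  | some c, S, some d, B =>
    if c = d then
      if B = S then
        (if c ∈ S then oplusOne (α + β) γ x else x) * (α * β) ^ above c S
      else 0
    else if c ∈ S ∧ d ∉ S ∧ B = (insert d S).erase c then
      if c < d then (-α) ^ above d S * (-β) ^ above c S * oplusOne α γ x
      else (-α) ^ above d B * (-β) ^ above c S * oplusOne β γ x
    else 0

/-- A state of the grid with rows `0, …, n - 1` from top to bottom and columns `N, …, 1, 0` from
left to right: the labels of all horizontal and of all vertical edges. The vertex in row `i` and
column `m` has the left edge `horiz i m.succ`, the right edge `horiz i m.castSucc`, the top edge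
`vert i.castSucc m` and the bottom edge `vert i.succ m`. -/
abbrev State (n N : ℕ) : Type :=
  (Fin n → Fin (N + 2) → Option (Fin n)) × (Fin (n + 1) → Fin (N + 1) → Finset (Fin n))

/-- The Boltzmann weight of a state, row `i` having the spectral parameter `x i`. -/
def stateWeight (α β γ : A) (x : Fin n → A) {N : ℕ} (s : State n N) : A :=
  ∏ i : Fin n, ∏ m : Fin (N + 1),
    weight α β γ (x i) (s.1 i m.succ) (s.2 i.castSucc m) (s.1 i m.castSucc) (s.2 i.succ m)

/-- The boundary condition determined by `w₁`, `w₂` and `μ`. The label `n + 1 - w⁻¹(i)` becomes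
`(w⁻¹ i).rev` when counting from zero. -/
def HasBoundary {N : ℕ} (w₁ w₂ : Equiv.Perm (Fin n)) (μ : Fin n → ℕ) (s : State n N) : Prop :=
  (∀ i, s.1 i (Fin.last (N + 1)) = some (w₁⁻¹ i).rev) ∧
  (∀ i, s.1 i 0 = none) ∧
  (∀ m, s.2 0 m = (Finset.univ.filter fun i => μ i = m.1).image fun i => (w₂⁻¹ i).rev) ∧
  (∀ m, s.2 (Fin.last n) m = ∅)

instance {N : ℕ} (w₁ w₂ : Equiv.Perm (Fin n)) (μ : Fin n → ℕ) :
    DecidablePred (HasBoundary (N := N) w₁ w₂ μ) :=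
  fun _ => by unfold HasBoundary; infer_instance

/-- The partition function of the system with `n` rows, `N + 1` columns and the boundary
condition determined by `w₁`, `w₂` and `μ`. -/
def partitionFn (α β γ : A) (x : Fin n → A) (N : ℕ) (w₁ w₂ : Equiv.Perm (Fin n))
    (μ : Fin n → ℕ) : A :=
  ∑ s : State n N with HasBoundary w₁ w₂ μ s, stateWeight α β γ x s

/-- The long permutation `w₀`. -/
def longPerm : Equiv.Perm (Fin n) := Fin.revPerm

/-- The constant: for every distinct value `p` of `μ`, of multiplicity `n_p`, the product over
`j = 1, …, n_p` of `(-1)^(j-1) (-α β h_{j-3}(α, β) - γ h_{j-2}(α, β))`. -/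
def normConst (α β γ : A) (μ : Fin n → ℕ) : A :=
  ∏ p ∈ Finset.univ.image μ, ∏ j ∈ Finset.Icc 1 (Finset.univ.filter fun i => μ i = p).card,
    (-1) ^ (j - 1) * (-abh α β ((j : ℤ) - 3) - γ * hsym α β ((j : ℤ) - 2))

/-- The partition function `Z(𝔖_{v_ζ}^{μ - ρ})`, as a polynomial in `x_1, …, x_n`: there are
`n` rows and `ζ⁺_1 + 1` columns, and the boundary is given by `v_ζ`, `w₀` and `μ`. -/
noncomputable def keyPartitionFn {F : Type*} [Field F] [NeZero n] (α β γ : F) (ζ : Fin n → ℕ) :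
    MvPolynomial (Fin n) F :=
  partitionFn (MvPolynomial.C α) (MvPolynomial.C β) (MvPolynomial.C γ) MvPolynomial.X
    (plus ζ 0) (vPerm ζ) longPerm (muOf ζ)

end Lattice

end KeyLattice

/-! The weights are solvable. An R-vertex, which either keeps or exchanges its two labels, commutes
past a column of two vertices (`twoWeight_ybe`). Pushing it through two adjacent rows, from the left
boundary labels `c`, `d` with `d < c` to the right boundary `+`, `+`, gives a three-term relation
between partition functions (`transfer_exchange`, `partitionFn_exchange`). Its coefficients are
those of `T_i` after multiplication by `x_{i+1} - x_i`. Hence `T_i` maps the partition function for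
`w` to the one for `s_i w` whenever `s_i w` is longer than `w` (`domKirOp_polyZ`).

For `w = 1` only one state survives, and its weight is `C` times the monomial with exponent `ζ⁺`
(`partitionFn_one`). Induction along a reduced word gives `C · T_ω(x^{ζ⁺}) = Z` for every reduced
word `ω`.

The braid relations are never checked. For indeterminate parameters `C` is nonzero, because it
becomes `±1` at `α = 0`, `β = γ = 1`. There it can be cancelled, so `T_ω(x^{ζ⁺})` depends only on
the permutation; specializing the parameters gives the same over every field
(`wordOp_eq_of_isReduced`).

Uniqueness of `v_ζ` comes from the strong exchange condition: a sorter of minimal length is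
increasing on each block of equal parts of `ζ⁺`. The corollary holds because the operators commute
with multiplication by the symmetric polynomial `x_1 ⋯ x_n`. -/

namespace KeyLattice

/-! ### The Yang–Baxter relation for a column of two vertices. -/

section YangBaxter

variable {A : Type*} [CommRing A] {n : ℕ}

/-- Conservation of colors at a vertex with the labels `l` (left), `S` (top), `r` (right) and
`B` (bottom). -/
def Conserved (l : Option (Fin n)) (S : Finset (Fin n)) (r : Option (Fin n))
    (B : Finset (Fin n)) : Prop :=
  ∀ z, (if z ∈ B then 1 else 0) + (if l = some z then 1 else 0)
    = (if z ∈ S then 1 else 0) + (if r = some z then 1 else 0)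

/-- The bottom label of a vertex that is forced by the other three labels. -/
def bottom (l : Option (Fin n)) (S : Finset (Fin n)) (r : Option (Fin n)) : Finset (Fin n) :=
  match l, r with
  | none, none => S
  | none, some d => insert d S
  | some c, none => S.erase c
  | some c, some d => if c = d then S else (insert d S).erase c

/-- `h_{m-1}`, for a natural number `m`. -/
def hPred (α β : A) (m : ℕ) : A := hsym α β ((m : ℤ) - 1)

/-- `α β h_{m-2}`, for a natural number `m`. -/
def abhPred (α β : A) (m : ℕ) : A := abh α β ((m : ℤ) - 2)

theorem hsym_natCast (α β : A) (k : ℕ) :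
    hsym α β (k : ℤ) = ∑ i ∈ Finset.range (k + 1), α ^ i * β ^ (k - i) := by
  simp [hsym]

theorem hsym_succ (α β : A) (k : ℕ) :
    hsym α β ((k : ℤ) + 1) = β * hsym α β (k : ℤ) + α ^ (k + 1) := by
  have := hsym_natCast α β (k + 1)
  push_cast at this
  rw [this, hsym_natCast, Finset.sum_range_succ, Finset.mul_sum]
  simp only [Nat.sub_self, pow_zero, mul_one, add_left_inj]
  refine Finset.sum_congr rfl fun i hi => ?_
  rw [Finset.mem_range] at hi
  rw [show k + 1 - i = (k - i) + 1 by omega, pow_succ]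
  ring

@[simp] theorem hPred_zero (α β : A) : hPred α β 0 = 0 := by simp [hPred, hsym]

@[simp] theorem abhPred_zero (α β : A) : abhPred α β 0 = -1 := by simp [abhPred, abh]

theorem hPred_succ_eq (α β : A) (m : ℕ) : hPred α β (m + 1) = hsym α β (m : ℤ) := by
  simp [hPred]

theorem abhPred_succ (α β : A) (m : ℕ) : abhPred α β (m + 1) = α * β * hPred α β m := by
  simp only [abhPred, abh, hPred]
  rw [if_neg (by push_cast; omega)]
  congr 2
  push_cast; ring

theorem hPred_succ_succ_eq (α β : A) (m : ℕ) :
    hPred α β (m + 2) = β * hPred α β (m + 1) + α ^ (m + 1) := by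
  rw [hPred_succ_eq, hPred_succ_eq]
  push_cast
  exact hsym_succ α β m

/-- This is the recursion `h_m = (α + β) h_{m-1} - α β h_{m-2}`, which starts at `m = 0` thanks to
the convention `α β h_{-2} = -1`. With `abhPred_succ` it makes the weights at an enlarged label set
linear in `hPred` and `abhPred` of the original set, so that these two can be treated as free
variables. -/
theorem hPred_succ (α β : A) (m : ℕ) :
    hPred α β (m + 1) = (α + β) * hPred α β m - abhPred α β m := by
  match m with
  | 0 => simp [hPred_succ_eq, hsym]
  | 1 => rw [hPred_succ_succ_eq, abhPred_succ]; simp [hPred_succ_eq, hsym]; ring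
  | m + 2 =>
    rw [hPred_succ_succ_eq, abhPred_succ, hPred_succ_succ_eq]
    ring

/-- The weight of a vertex whose bottom label is the one forced by the other three, made homogeneous
in the spectral parameter `(x, u)`; the original weights are those for `ρ = α + γ` and
`u = 1 + ρ x`. -/
def vertexWeight (α β ρ x u : A) : Option (Fin n) → Finset (Fin n) → Option (Fin n) → A
  | none, S, none =>
    (-1) ^ (S.card + 1) * ((ρ * (u + β * x) - α * u) * hPred α β S.card
      + (u - ρ * x) * abhPred α β S.card)
  | none, S, some d =>
    if d ∈ S then 0 else (-α) ^ above d S * u * (u + (β - α) * x)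
  | some c, S, none =>
    if c ∈ S then (-1) ^ S.card * (-β) ^ above c S
      * (abhPred α β (S.card - 1) + (ρ - α) * hPred α β (S.card - 1)) else 0
  | some c, S, some d =>
    if c = d then (if c ∈ S then u + β * x else x) * ((-α) ^ above c S * (-β) ^ above c S)
    else if c ∈ S then
      if d ∈ S then 0
      else if c < d then (-α) ^ above d S * (-β) ^ above c S * u
      else (-α) ^ above d ((insert d S).erase c) * (-β) ^ above c S * (u + (β - α) * x)
    else 0

theorem oplusOne_eq (α β γ x : A) : oplusOne β γ x = oplusOne α γ x + (β - α) * x := by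
  simp only [oplusOne]; ring

theorem oplusOne_add_eq (α β γ x : A) : oplusOne (α + β) γ x = oplusOne α γ x + β * x := by
  simp only [oplusOne]; ring

/-- Since colors are conserved, the bottom label carries no information. Separating it leaves
weights depending on three labels, and the Yang–Baxter identities for these hold without using `u =
1 + ρ x`. -/
theorem weight_eq (α β γ x : A) (l : Option (Fin n)) (S : Finset (Fin n)) (r : Option (Fin n))
    (B : Finset (Fin n)) :
    weight α β γ x l S r B
      = if B = bottom l S r then vertexWeight α β (α + γ) x (oplusOne α γ x) l S r else 0 := by
  rcases l with _ | c <;> rcases r with _ | d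
  · simp only [weight, bottom, vertexWeight, hPred, abhPred, oplusOne]
    by_cases hB : B = S <;> simp only [hB, if_true, if_false]
    ring
  · simp only [weight, bottom, vertexWeight, oplusOne_eq α β]
    split_ifs <;> simp_all
  · simp only [weight, bottom, vertexWeight, hPred, abhPred]
    by_cases h : c ∈ S
    · have : 0 < S.card := Finset.card_pos.2 ⟨c, h⟩
      have e : ((S.card - 1 : ℕ) : ℤ) = S.card - 1 := by omega
      rw [e, add_sub_cancel_left]
      simp only [h, true_and, if_true]
      congr 4 <;> ring_nf
    · simp [h]
  · simp only [weight, bottom, vertexWeight, oplusOne_eq α β, oplusOne_add_eq]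
    by_cases h : c = d
    · simp [h, ← mul_pow]
    · by_cases h1 : c ∈ S <;> by_cases h2 : d ∈ S <;> by_cases h3 : c < d <;>
        by_cases hB : B = (insert d S).erase c <;> simp [h, h1, h2, h3, hB]

theorem conserved_bottom {α β ρ x u : A} {l : Option (Fin n)} {S : Finset (Fin n)}
    {r : Option (Fin n)} (h : vertexWeight α β ρ x u l S r ≠ 0) :
    Conserved l S r (bottom l S r) := by
  intro z
  rcases l with _ | c <;> rcases r with _ | d <;> simp only [bottom, vertexWeight] at h ⊢
  · rfl
  · have : d ∉ S := fun hd => h (if_pos hd)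
    by_cases hz : d = z
    · subst hz; simp [this]
    · simp [hz, Ne.symm hz]
  · have : c ∈ S := by by_contra hd; exact h (if_neg hd)
    by_cases hz : c = z
    · subst hz; simp [this]
    · simp [hz, Ne.symm hz]
  · by_cases hcd : c = d
    · simp [hcd]
    · rw [if_neg hcd] at h
      have h1 : c ∈ S := by by_contra hd; exact h (if_neg hd)
      rw [if_pos h1] at h
      have h2 : d ∉ S := fun hd => h (if_pos hd)
      by_cases hz : c = z
      · subst hz; simp [h1, hcd, Ne.symm hcd]
      · by_cases hz' : d = z
        · subst hz'; simp [h2, hcd, Ne.symm hcd]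
        · simp [hz, hz', hcd, Ne.symm hz, Ne.symm hz']

theorem Conserved.eq_bottom {l : Option (Fin n)} {S : Finset (Fin n)} {r : Option (Fin n)}
    {B : Finset (Fin n)} (h : Conserved l S r B) : B = bottom l S r := by
  ext z
  have hz := h z
  rcases l with _ | c <;> rcases r with _ | d <;> simp only [bottom]
  · by_cases h1 : z ∈ B <;> by_cases h2 : z ∈ S <;> simp_all
  · by_cases h1 : z ∈ B <;> by_cases h2 : z ∈ S <;> by_cases h3 : d = z <;> simp_all [eq_comm]
  · by_cases h1 : z ∈ B <;> by_cases h2 : z ∈ S <;> by_cases h3 : c = z <;> simp_all [eq_comm]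
  · by_cases h0 : c = d
    · by_cases h1 : z ∈ B <;> by_cases h2 : z ∈ S <;> simp_all
    · by_cases h1 : z ∈ B <;> by_cases h2 : z ∈ S <;> by_cases h3 : d = z <;>
        by_cases h4 : c = z <;> simp_all [eq_comm]

/-- The weight of a column of two vertices, the upper one with spectral parameter `x` and labels
`a` (left) and `p` (right), the lower one with spectral parameter `y` and labels `b` and `q`. -/
def twoWeight (α β γ x y : A) (S T : Finset (Fin n)) (p q a b : Option (Fin n)) : A :=
  ∑ M, weight α β γ x a S p M * weight α β γ y b M q T

/-- The product of the weights of the two vertices of a column whose bottom labels are forced. -/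
def twoVertex (α β ρ x u y v : A) (S : Finset (Fin n)) (p q a b : Option (Fin n)) : A :=
  vertexWeight α β ρ x u a S p * vertexWeight α β ρ y v b (bottom a S p) q

/-- Conservation of colors for a column of two vertices. -/
def Conserved₂ (a b : Option (Fin n)) (S : Finset (Fin n)) (p q : Option (Fin n))
    (T : Finset (Fin n)) : Prop :=
  ∀ z, (if z ∈ T then 1 else 0) + (if a = some z then 1 else 0) + (if b = some z then 1 else 0)
    = (if z ∈ S then 1 else 0) + (if p = some z then 1 else 0) + (if q = some z then 1 else 0)

/-- The upper vertex forces the label of the inner edge, so a single summand remains. The condition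
on `T` is symmetric in `a`, `b` and in `p`, `q`, hence common to all four terms of the Yang–Baxter
relation. -/
theorem twoWeight_eq (α β γ x y : A) (S T : Finset (Fin n)) (p q a b : Option (Fin n)) :
    twoWeight α β γ x y S T p q a b =
      open Classical in if Conserved₂ a b S p q T then
        twoVertex α β (α + γ) x (oplusOne α γ x) y (oplusOne α γ y) S p q a b else 0 := by
  classical
  rw [twoWeight, Finset.sum_eq_single (bottom a S p)]
  · rw [weight_eq, if_pos rfl, weight_eq]
    unfold twoVertex
    by_cases h0 : vertexWeight α β (α + γ) x (oplusOne α γ x) a S p = 0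
    · simp [h0]
    have h1 := conserved_bottom h0
    by_cases h : Conserved₂ a b S p q T
    · have : Conserved b (bottom a S p) q T := by
        intro z
        have := h z
        have := h1 z
        omega
      rw [if_pos h, if_pos this.eq_bottom]
    · rw [if_neg h]
      by_cases h3 : vertexWeight α β (α + γ) y (oplusOne α γ y) b (bottom a S p) q = 0
      · simp [h3]
      rw [if_neg, mul_zero]
      rintro rfl
      refine h fun z => ?_
      have := conserved_bottom h3 z
      have := h1 z
      omega
  · intro M _ hM
    rw [weight_eq, if_neg hM, zero_mul]
  · simp

/-- The Boltzmann weights of the straight configurations of the R-vertex. -/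
def rDiag (α β x u y v : A) : Option (Fin n) → Option (Fin n) → A
  | none, none => u * v - α * y * u + β * x * v
  | none, some _ => v * (v + (β - α) * y)
  | some _, none => u * (u + (β - α) * x)
  | some c, some d =>
    if c = d then u * v - α * x * v + β * y * u
    else if d < c then u * (v + (β - α) * y) else v * (u + (β - α) * x)

/-- The Boltzmann weights of the exchanging configurations of the R-vertex. -/
def rSwap (α β x u y v : A) : Option (Fin n) → Option (Fin n) → A
  | none, none => 0
  | none, some _ => α * β * (y * u - x * v)
  | some _, none => y * u - x * v
  | some c, some d =>
    if c = d then 0 else if d < c then y * u - x * v else α * β * (y * u - x * v)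

theorem above_insert_of_lt {c d : Fin n} {S : Finset (Fin n)} (hd : d ∉ S) (h : c < d) :
    above c (insert d S) = above c S + 1 := by
  unfold above
  rw [Finset.filter_insert, if_pos h, Finset.card_insert_of_notMem (by simp [hd])]

theorem above_insert_of_le {c d : Fin n} {S : Finset (Fin n)} (h : d ≤ c) :
    above c (insert d S) = above c S := by
  unfold above
  rw [Finset.filter_insert, if_neg (not_lt.2 h)]

theorem above_erase_self {c : Fin n} {S : Finset (Fin n)} :
    above c (S.erase c) = above c S := by
  unfold above
  congr 1
  ext z; simp only [Finset.mem_filter, Finset.mem_erase]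
  constructor
  · rintro ⟨⟨_, h⟩, h'⟩; exact ⟨h, h'⟩
  · rintro ⟨h, h'⟩; exact ⟨⟨h'.ne', h⟩, h'⟩

/-- The commutation relation between the R-vertex and a column of two vertices. -/
def YBE (α β ρ x u y v : A) (S : Finset (Fin n)) (p q a b : Option (Fin n)) : Prop :=
  twoVertex α β ρ x u y v S p q a b * rDiag α β x u y v a b
      + twoVertex α β ρ x u y v S p q b a * rSwap α β x u y v a b
    = rDiag α β x u y v p q * twoVertex α β ρ y v x u S p q a b
      + rSwap α β x u y v q p * twoVertex α β ρ y v x u S q p a b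

-- The set `S` avoids all colors on the horizontal edges, so every exponent `above` is its value at
-- `S` plus an offset decided by the order of these colors. For each order the powers are replaced
-- by free variables and a polynomial identity remains. The lemmas for three, two, one and no colors
-- follow the same pattern; they list the label patterns needed after conservation of colors.
set_option linter.unusedSimpArgs false in
set_option maxHeartbeats 2000000 in
theorem ybe_distinct (α β ρ x u y v : A) (S : Finset (Fin n)) (a b p q : Fin n)
    (hab : a ≠ b) (hap : a ≠ p) (haq : a ≠ q) (hbp : b ≠ p) (hbq : b ≠ q) (hpq : p ≠ q)
    (ha : a ∉ S) (hb : b ∉ S) (hp : p ∉ S) (hq : q ∉ S) :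
    YBE α β ρ x u y v (insert a (insert b S)) (some p) (some q) (some a) (some b) := by
  unfold YBE twoVertex
  rcases lt_or_gt_of_ne hab with h1 | h1 <;> rcases lt_or_gt_of_ne hap with h2 | h2 <;>
  rcases lt_or_gt_of_ne haq with h3 | h3 <;> rcases lt_or_gt_of_ne hbp with h4 | h4 <;>
  rcases lt_or_gt_of_ne hbq with h5 | h5 <;> rcases lt_or_gt_of_ne hpq with h6 | h6 <;>
  first
  | (exfalso; omega)
  | (simp [vertexWeight, bottom, rDiag, rSwap, above_insert_of_lt, above_insert_of_le,
      Finset.erase_insert_of_ne, pow_succ, *, Ne.symm, h1.le, h1.ne, h1.ne', h1.not_gt,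
      h2.le, h2.ne, h2.ne', h2.not_gt, h3.le, h3.ne, h3.ne', h3.not_gt, h4.le, h4.ne, h4.ne',
      h4.not_gt, h5.le, h5.ne, h5.ne', h5.not_gt, h6.le, h6.ne, h6.ne', h6.not_gt]
     try (generalize (-α) ^ above p S = a1, (-α) ^ above q S = a2, (-β) ^ above a S = b1,
       (-β) ^ above b S = b2; ring))

set_option linter.unusedSimpArgs false in
set_option maxHeartbeats 2000000 in
theorem ybe_three (α β ρ x u y v : A) (S : Finset (Fin n)) (c d e : Fin n)
    (hcd : c ≠ d) (hce : c ≠ e) (hde : d ≠ e) (hc : c ∉ S) (hd : d ∉ S) (he : e ∉ S) :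
    (YBE α β ρ x u y v (insert d S) (some c) (some e) (some c) (some d) ∧
    YBE α β ρ x u y v (insert d S) (some e) (some c) (some c) (some d) ∧
    YBE α β ρ x u y v (insert d S) (some c) (some e) (some d) (some c) ∧
    YBE α β ρ x u y v (insert d S) (some e) (some c) (some d) (some c)) ∧
    (YBE α β ρ x u y v (insert c (insert d S)) (some c) (some e) (some c) (some d) ∧
    YBE α β ρ x u y v (insert c (insert d S)) (some e) (some c) (some c) (some d) ∧
    YBE α β ρ x u y v (insert c (insert d S)) (some c) (some e) (some d) (some c) ∧
    YBE α β ρ x u y v (insert c (insert d S)) (some e) (some c) (some d) (some c)) ∧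
    (YBE α β ρ x u y v (insert c S) (some d) (some e) none (some c) ∧
    YBE α β ρ x u y v (insert c S) (some d) (some e) (some c) none) ∧
    (YBE α β ρ x u y v (insert c (insert d S)) none (some e) (some c) (some d) ∧
    YBE α β ρ x u y v (insert c (insert d S)) (some e) none (some c) (some d)) := by
  unfold YBE twoVertex
  rcases lt_or_gt_of_ne hcd with h1 | h1 <;> rcases lt_or_gt_of_ne hce with h2 | h2 <;>
  rcases lt_or_gt_of_ne hde with h3 | h3 <;>
  first
  | (exfalso; omega)
  | (simp [vertexWeight, bottom, rDiag, rSwap, above_insert_of_lt, above_insert_of_le,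
      Finset.erase_insert_of_ne, hPred_succ, abhPred_succ, pow_succ, *, Ne.symm, h1.le, h1.ne,
      h1.ne', h1.not_gt, h2.le, h2.ne, h2.ne', h2.not_gt, h3.le, h3.ne, h3.ne', h3.not_gt]
     generalize (-α) ^ above c S = a1, (-α) ^ above d S = a2, (-α) ^ above e S = a3,
       (-β) ^ above c S = b1, (-β) ^ above d S = b2, (-β) ^ above e S = b3,
       hPred α β S.card = h, abhPred α β S.card = k, (-1 : A) ^ S.card = s
     (refine ⟨⟨?_, ?_, ?_, ?_⟩, ⟨?_, ?_, ?_, ?_⟩, ⟨?_, ?_⟩, ?_, ?_⟩ <;> ring))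

set_option linter.unusedSimpArgs false in
set_option maxHeartbeats 2000000 in
theorem ybe_two (α β ρ x u y v : A) (S : Finset (Fin n)) (c d : Fin n)
    (hcd : c ≠ d) (hc : c ∉ S) (hd : d ∉ S) :
    ((YBE α β ρ x u y v S (some c) (some d) (some c) (some d) ∧
    YBE α β ρ x u y v (insert c S) (some c) (some d) (some c) (some d) ∧
    YBE α β ρ x u y v (insert d S) (some c) (some d) (some c) (some d) ∧
    YBE α β ρ x u y v (insert c (insert d S)) (some c) (some d) (some c) (some d)) ∧
    (YBE α β ρ x u y v S (some d) (some c) (some c) (some d) ∧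
    YBE α β ρ x u y v (insert c S) (some d) (some c) (some c) (some d) ∧
    YBE α β ρ x u y v (insert d S) (some d) (some c) (some c) (some d) ∧
    YBE α β ρ x u y v (insert c (insert d S)) (some d) (some c) (some c) (some d)) ∧
    (YBE α β ρ x u y v (insert c S) (some c) (some d) (some c) (some c) ∧
    YBE α β ρ x u y v (insert c S) (some d) (some c) (some c) (some c) ∧
    YBE α β ρ x u y v (insert d S) (some c) (some c) (some c) (some d) ∧
    YBE α β ρ x u y v (insert d S) (some c) (some c) (some d) (some c))) ∧
    ((YBE α β ρ x u y v S (some c) (some d) none (some c) ∧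
    YBE α β ρ x u y v S (some d) (some c) none (some c) ∧
    YBE α β ρ x u y v S (some c) (some d) (some c) none ∧
    YBE α β ρ x u y v S (some d) (some c) (some c) none) ∧
    (YBE α β ρ x u y v (insert c S) (some c) (some d) none (some c) ∧
    YBE α β ρ x u y v (insert c S) (some d) (some c) none (some c) ∧
    YBE α β ρ x u y v (insert c S) (some c) (some d) (some c) none ∧
    YBE α β ρ x u y v (insert c S) (some d) (some c) (some c) none) ∧
    (YBE α β ρ x u y v (insert d S) none (some c) (some c) (some d) ∧
    YBE α β ρ x u y v (insert d S) (some c) none (some c) (some d) ∧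
    YBE α β ρ x u y v (insert d S) none (some c) (some d) (some c) ∧
    YBE α β ρ x u y v (insert d S) (some c) none (some d) (some c)) ∧
    (YBE α β ρ x u y v (insert c (insert d S)) none (some c) (some c) (some d) ∧
    YBE α β ρ x u y v (insert c (insert d S)) (some c) none (some c) (some d) ∧
    YBE α β ρ x u y v (insert c (insert d S)) none (some c) (some d) (some c) ∧
    YBE α β ρ x u y v (insert c (insert d S)) (some c) none (some d) (some c))) ∧
    ((YBE α β ρ x u y v S (some c) (some d) none none ∧
    YBE α β ρ x u y v (insert c (insert d S)) none none (some c) (some d)) ∧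
    (YBE α β ρ x u y v (insert c S) none (some d) none (some c) ∧
    YBE α β ρ x u y v (insert c S) (some d) none none (some c) ∧
    YBE α β ρ x u y v (insert c S) none (some d) (some c) none ∧
    YBE α β ρ x u y v (insert c S) (some d) none (some c) none)) := by
  unfold YBE twoVertex
  rcases lt_or_gt_of_ne hcd with h1 | h1 <;>
  refine ⟨⟨⟨?_, ?_, ?_, ?_⟩, ⟨?_, ?_, ?_, ?_⟩, ?_, ?_, ?_, ?_⟩,
    ⟨⟨?_, ?_, ?_, ?_⟩, ⟨?_, ?_, ?_, ?_⟩, ⟨?_, ?_, ?_, ?_⟩, ?_, ?_, ?_, ?_⟩,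
    ⟨?_, ?_⟩, ?_, ?_, ?_, ?_⟩ <;>
  (simp [vertexWeight, bottom, rDiag, rSwap, above_insert_of_lt, above_insert_of_le,
      above_erase_self, Finset.erase_insert_of_ne, hPred_succ, abhPred_succ, pow_succ, *, Ne.symm,
      h1.le, h1.ne, h1.ne', h1.not_gt]
   try (generalize (-α) ^ above c S = a1, (-α) ^ above d S = a2, (-β) ^ above c S = b1,
     (-β) ^ above d S = b2, hPred α β S.card = h, abhPred α β S.card = k, (-1 : A) ^ S.card = s; ring))

theorem ybe_one (α β ρ x u y v : A) (S : Finset (Fin n)) (c : Fin n) (hc : c ∉ S) :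
    ((YBE α β ρ x u y v S (some c) (some c) (some c) (some c) ∧
    YBE α β ρ x u y v (insert c S) (some c) (some c) (some c) (some c)) ∧
    (YBE α β ρ x u y v S (some c) (some c) none (some c) ∧
    YBE α β ρ x u y v S (some c) (some c) (some c) none ∧
    YBE α β ρ x u y v (insert c S) none (some c) (some c) (some c) ∧
    YBE α β ρ x u y v (insert c S) (some c) none (some c) (some c))) ∧
    ((YBE α β ρ x u y v S none (some c) none (some c) ∧
    YBE α β ρ x u y v S (some c) none none (some c) ∧
    YBE α β ρ x u y v S none (some c) (some c) none ∧
    YBE α β ρ x u y v S (some c) none (some c) none) ∧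
    (YBE α β ρ x u y v (insert c S) none (some c) none (some c) ∧
    YBE α β ρ x u y v (insert c S) (some c) none none (some c) ∧
    YBE α β ρ x u y v (insert c S) none (some c) (some c) none ∧
    YBE α β ρ x u y v (insert c S) (some c) none (some c) none)) ∧
    (YBE α β ρ x u y v S (some c) none none none ∧
    YBE α β ρ x u y v S none (some c) none none ∧
    YBE α β ρ x u y v (insert c S) none none (some c) none ∧
    YBE α β ρ x u y v (insert c S) none none none (some c)) := by
  unfold YBE twoVertex
  refine ⟨⟨⟨?_, ?_⟩, ?_, ?_, ?_, ?_⟩,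
    ⟨⟨?_, ?_, ?_, ?_⟩, ?_, ?_, ?_, ?_⟩, ?_, ?_, ?_, ?_⟩ <;>
  (simp [vertexWeight, bottom, rDiag, rSwap, above_insert_of_le, hPred_succ, abhPred_succ,
      pow_succ, hc]
   try (generalize (-α) ^ above c S = a1, (-β) ^ above c S = b1,
     hPred α β S.card = h, abhPred α β S.card = k, (-1 : A) ^ S.card = s; ring))

theorem ybe_zero (α β ρ x u y v : A) (S : Finset (Fin n)) :
    YBE α β ρ x u y v S none none none none := by
  unfold YBE twoVertex
  simp [vertexWeight, bottom, rDiag, rSwap]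
  ring

/-- Removing the colors of the horizontal edges from the top label brings it into the form used in
the finite list of identities. -/
theorem exists_base (u : Fin n) (S : Finset (Fin n)) :
    ∃ S₀, u ∉ S₀ ∧ (S = S₀ ∨ S = insert u S₀) := by
  by_cases h : u ∈ S
  · exact ⟨S.erase u, by simp, Or.inr (by simp [h])⟩
  · exact ⟨S, h, Or.inl rfl⟩

theorem exists_base₂ {u v : Fin n} (huv : u ≠ v) (S : Finset (Fin n)) :
    ∃ S₀, u ∉ S₀ ∧ v ∉ S₀ ∧
      (S = S₀ ∨ S = insert u S₀ ∨ S = insert v S₀ ∨ S = insert u (insert v S₀)) := by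
  obtain ⟨S₁, h1, h2⟩ := exists_base u S
  obtain ⟨S₀, h3, h4⟩ := exists_base v S₁
  exact ⟨S₀, by grind, h3, by grind⟩

theorem exists_base₃ {u v w : Fin n} (huv : u ≠ v) (huw : u ≠ w) (hvw : v ≠ w)
    (S : Finset (Fin n)) :
    ∃ S₀, u ∉ S₀ ∧ v ∉ S₀ ∧ w ∉ S₀ ∧
      ((S = S₀ ∨ S = insert w S₀ ∨ S = insert v S₀ ∨ S = insert v (insert w S₀)) ∨
      S = insert u S₀ ∨ S = insert u (insert w S₀) ∨ S = insert u (insert v S₀) ∨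
      S = insert u (insert v (insert w S₀))) := by
  obtain ⟨S₁, h1, h2⟩ := exists_base u S
  obtain ⟨S₀, h3, h4, h5⟩ := exists_base₂ hvw S₁
  exact ⟨S₀, by grind, h3, h4, by grind⟩

theorem YBE.of_conserved_one {α β ρ x s y t : A} {a b p q : Option (Fin n)} {S T : Finset (Fin n)}
    (h : Conserved₂ a b S p q T) (u : Fin n) (ha : a = none ∨ a = some u)
    (hb : b = none ∨ b = some u) (hp : p = none ∨ p = some u) (hq : q = none ∨ q = some u) :
    YBE α β ρ x s y t S p q a b := by
  have hu := h u
  obtain ⟨S₀, h0, hS⟩ := exists_base u S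
  have L := ybe_one α β ρ x s y t S₀ u h0
  rcases ha with rfl | rfl <;> rcases hb with rfl | rfl <;> rcases hp with rfl | rfl <;>
    rcases hq with rfl | rfl <;> rcases hS with rfl | rfl <;>
    first
    | apply ybe_zero
    | simp only [L]
    | (exfalso; grind)

set_option maxHeartbeats 4000000 in
theorem YBE.of_conserved_two {α β ρ x s y t : A} {a b p q : Option (Fin n)} {S T : Finset (Fin n)}
    (h : Conserved₂ a b S p q T) {u v : Fin n} (huv : u ≠ v)
    (ha : a = none ∨ a = some u ∨ a = some v) (hb : b = none ∨ b = some u ∨ b = some v)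
    (hp : p = none ∨ p = some u ∨ p = some v) (hq : q = none ∨ q = some u ∨ q = some v) :
    YBE α β ρ x s y t S p q a b := by
  by_cases hu : a ≠ some u ∧ b ≠ some u ∧ p ≠ some u ∧ q ≠ some u
  · exact .of_conserved_one h v (by tauto) (by tauto) (by tauto) (by tauto)
  by_cases hv : a ≠ some v ∧ b ≠ some v ∧ p ≠ some v ∧ q ≠ some v
  · exact .of_conserved_one h u (by tauto) (by tauto) (by tauto) (by tauto)
  have h1 := h u
  have h2 := h v
  obtain ⟨S₀, hu0, hv0, hS⟩ := exists_base₂ huv S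
  have L := ybe_two α β ρ x s y t S₀ u v huv hu0 hv0
  -- The list in `ybe_two` contains only half of the patterns; exchanging the two colors supplies
  -- the rest.
  have L' := ybe_two α β ρ x s y t S₀ v u huv.symm hv0 hu0
  rw [Finset.insert_comm v u] at L'
  clear h
  rcases ha with rfl | rfl | rfl <;> rcases hb with rfl | rfl | rfl <;>
    rcases hp with rfl | rfl | rfl <;> rcases hq with rfl | rfl | rfl <;>
    first
    | (exfalso; simp at hu hv; done)
    | (rcases hS with rfl | rfl | rfl | rfl <;>
      first
      | simp only [L, L']
      | (exfalso; clear L L'; grind))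

theorem YBE.of_conserved_pair {α β ρ x s y t : A} {a b p q : Option (Fin n)} {S T : Finset (Fin n)}
    (h : Conserved₂ a b S p q T) (u v : Fin n)
    (ha : a = none ∨ a = some u ∨ a = some v) (hb : b = none ∨ b = some u ∨ b = some v)
    (hp : p = none ∨ p = some u ∨ p = some v) (hq : q = none ∨ q = some u ∨ q = some v) :
    YBE α β ρ x s y t S p q a b := by
  by_cases huv : u = v
  · subst huv
    exact .of_conserved_one h u (by tauto) (by tauto) (by tauto) (by tauto)
  · exact .of_conserved_two h huv ha hb hp hq

theorem YBE.of_conserved_three {α β ρ x s y t : A} {a b p q : Option (Fin n)} {S T : Finset (Fin n)}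
    (h : Conserved₂ a b S p q T) {u v w : Fin n} (huv : u ≠ v) (huw : u ≠ w) (hvw : v ≠ w)
    (h' : (a = some u ∧ b = some v ∧ p = some u ∧ q = some w) ∨
      (a = some u ∧ b = some v ∧ p = some w ∧ q = some u) ∨
      (a = some v ∧ b = some u ∧ p = some u ∧ q = some w) ∨
      (a = some v ∧ b = some u ∧ p = some w ∧ q = some u) ∨
      (a = none ∧ b = some u ∧ p = some v ∧ q = some w) ∨
      (a = some u ∧ b = none ∧ p = some v ∧ q = some w) ∨
      (a = some u ∧ b = some v ∧ p = none ∧ q = some w) ∨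
      (a = some u ∧ b = some v ∧ p = some w ∧ q = none)) :
    YBE α β ρ x s y t S p q a b := by
  have h1 := h u
  have h2 := h v
  have h3 := h w
  clear h
  obtain ⟨S₀, hu, hv, hw, hS⟩ := exists_base₃ huv huw hvw S
  have L := ybe_three α β ρ x s y t S₀ u v w huv huw hvw hu hv hw
  rcases h' with h' | h' | h' | h' | h' | h' | h' | h' <;> obtain ⟨rfl, rfl, rfl, rfl⟩ := h' <;>
  rcases hS with (rfl | rfl | rfl | rfl) | rfl | rfl | rfl | rfl <;>
  first
  | simp only [L]
  | (exfalso; clear L; grind)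

/-- The cases are sorted by the coincidences among the four horizontal labels. Four distinct colors
force both left ones into `S` and both right ones out of it. -/
theorem YBE.of_conserved {α β ρ x s y t : A} {a b p q : Option (Fin n)} {S T : Finset (Fin n)}
    (h : Conserved₂ a b S p q T) : YBE α β ρ x s y t S p q a b := by
  rcases a with _ | a <;> rcases b with _ | b <;> rcases p with _ | p <;> rcases q with _ | q
  · apply ybe_zero
  · exact .of_conserved_one h q (by simp) (by simp) (by simp) (by simp)
  · exact .of_conserved_one h p (by simp) (by simp) (by simp) (by simp)
  · exact .of_conserved_pair h p q (by simp) (by simp) (by simp) (by simp)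
  · exact .of_conserved_one h b (by simp) (by simp) (by simp) (by simp)
  · exact .of_conserved_pair h b q (by simp) (by simp) (by simp) (by simp)
  · exact .of_conserved_pair h b p (by simp) (by simp) (by simp) (by simp)
  · by_cases h1 : b = p
    · exact .of_conserved_pair h b q (by simp) (by simp) (by simp [h1]) (by simp)
    by_cases h2 : b = q
    · exact .of_conserved_pair h b p (by simp) (by simp) (by simp) (by simp [h2])
    by_cases h3 : p = q
    · exact .of_conserved_pair h b p (by simp) (by simp) (by simp) (by simp [h3])
    exact .of_conserved_three h h1 h2 h3 (by simp)
  · exact .of_conserved_one h a (by simp) (by simp) (by simp) (by simp)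
  · exact .of_conserved_pair h a q (by simp) (by simp) (by simp) (by simp)
  · exact .of_conserved_pair h a p (by simp) (by simp) (by simp) (by simp)
  · by_cases h1 : a = p
    · exact .of_conserved_pair h a q (by simp) (by simp) (by simp [h1]) (by simp)
    by_cases h2 : a = q
    · exact .of_conserved_pair h a p (by simp) (by simp) (by simp) (by simp [h2])
    by_cases h3 : p = q
    · exact .of_conserved_pair h a p (by simp) (by simp) (by simp) (by simp [h3])
    exact .of_conserved_three h h1 h2 h3 (by simp)
  · exact .of_conserved_pair h a b (by simp) (by simp) (by simp) (by simp)
  · by_cases h1 : a = b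
    · exact .of_conserved_pair h a q (by simp) (by simp [h1]) (by simp) (by simp)
    by_cases h2 : a = q
    · exact .of_conserved_pair h a b (by simp) (by simp) (by simp) (by simp [h2])
    by_cases h3 : b = q
    · exact .of_conserved_pair h a b (by simp) (by simp) (by simp) (by simp [h3])
    exact .of_conserved_three h h1 h2 h3 (by simp)
  · by_cases h1 : a = b
    · exact .of_conserved_pair h a p (by simp) (by simp [h1]) (by simp) (by simp)
    by_cases h2 : a = p
    · exact .of_conserved_pair h a b (by simp) (by simp) (by simp [h2]) (by simp)
    by_cases h3 : b = p
    · exact .of_conserved_pair h a b (by simp) (by simp) (by simp [h3]) (by simp)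
    exact .of_conserved_three h h1 h2 h3 (by simp)
  · by_cases hab : a = b
    · have : a = p ∨ a = q := by
        have h1 := h a
        grind
      rcases this with h1 | h1
      · exact .of_conserved_pair h a q (by simp) (by simp [hab]) (by simp [h1]) (by simp)
      · exact .of_conserved_pair h a p (by simp) (by simp [hab]) (by simp) (by simp [h1])
    by_cases hpq : p = q
    · have : p = a ∨ p = b := by
        have h1 := h p
        grind
      rcases this with h1 | h1
      · exact .of_conserved_pair h p b (by simp [h1]) (by simp) (by simp) (by simp [hpq])
      · exact .of_conserved_pair h p a (by simp) (by simp [h1]) (by simp) (by simp [hpq])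
    by_cases hap : a = p
    · subst hap
      by_cases hbq : b = q
      · exact .of_conserved_pair h a b (by simp) (by simp) (by simp) (by simp [hbq])
      exact .of_conserved_three h hab hpq hbq (by simp)
    by_cases haq : a = q
    · subst haq
      by_cases hbp : b = p
      · exact .of_conserved_pair h a b (by simp) (by simp) (by simp [hbp]) (by simp)
      exact .of_conserved_three h hab hap hbp (by simp)
    by_cases hbp : b = p
    · subst hbp
      exact .of_conserved_three h (Ne.symm hab) hpq haq (by simp)
    by_cases hbq : b = q
    · subst hbq
      exact .of_conserved_three h (Ne.symm hab) hbp hap (by simp)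
    have h1 := h a
    have h2 := h b
    have h3 := h p
    have h4 := h q
    obtain ⟨S₁, ha, hS₁⟩ : ∃ S₁, a ∉ S₁ ∧ S = insert a S₁ :=
      ⟨S.erase a, by simp, by rw [Finset.insert_erase]; grind⟩
    subst hS₁
    obtain ⟨S₀, hb, hS₀⟩ : ∃ S₀, b ∉ S₀ ∧ S₁ = insert b S₀ :=
      ⟨S₁.erase b, by simp, by rw [Finset.insert_erase]; grind⟩
    subst hS₀
    exact ybe_distinct α β ρ x s y t S₀ a b p q hab hap haq hbp hbq hpq (by grind) hb
      (by grind) (by grind)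

theorem Conserved₂.swap_left {a b p q : Option (Fin n)} {S T : Finset (Fin n)} :
    Conserved₂ b a S p q T ↔ Conserved₂ a b S p q T := by
  refine forall_congr' fun z => ?_
  omega

theorem Conserved₂.swap_right {a b p q : Option (Fin n)} {S T : Finset (Fin n)} :
    Conserved₂ a b S q p T ↔ Conserved₂ a b S p q T := by
  refine forall_congr' fun z => ?_
  omega

theorem twoWeight_ybe (α β γ x y : A) (S T : Finset (Fin n)) (p q a b : Option (Fin n)) :
    twoWeight α β γ x y S T p q a b * rDiag α β x (oplusOne α γ x) y (oplusOne α γ y) a b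
      + twoWeight α β γ x y S T p q b a * rSwap α β x (oplusOne α γ x) y (oplusOne α γ y) a b
    = rDiag α β x (oplusOne α γ x) y (oplusOne α γ y) p q * twoWeight α β γ y x S T p q a b
      + rSwap α β x (oplusOne α γ x) y (oplusOne α γ y) q p
        * twoWeight α β γ y x S T q p a b := by
  classical
  simp only [twoWeight_eq, Conserved₂.swap_left (a := a) (b := b),
    Conserved₂.swap_right (p := p) (q := q)]
  by_cases h : Conserved₂ a b S p q T
  · simp only [h, if_true]
    exact YBE.of_conserved h
  · simp [h]

end YangBaxter

/-! ### Sums over paths as products of matrices. -/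

section Paths

variable {R X : Type*} [CommSemiring R] [Fintype X] [DecidableEq X]

/-- Sums over paths with fixed end points are entries of products of matrices. -/
theorem sum_path {N : ℕ} (K : Fin N → Matrix X X R) (q p : X) :
    (∑ h : Fin (N + 1) → X, if h 0 = q ∧ h (Fin.last N) = p then
      ∏ m, K m (h m.castSucc) (h m.succ) else 0) = (List.ofFn K).prod q p := by
  induction N generalizing q with
  | zero =>
    rw [Fintype.sum_equiv (Equiv.funUnique (Fin 1) X) _ (fun a => if a = q ∧ a = p then 1 else 0)]
    · by_cases h : q = p
      · subst h; simp
      · simp only [List.ofFn_zero, List.prod_nil, Matrix.one_apply, h, if_false]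
        refine Finset.sum_eq_zero fun a _ => if_neg ?_
        rintro ⟨rfl, rfl⟩; exact h rfl
    · intro h; simp
  | succ N ih =>
    rw [List.ofFn_succ, List.prod_cons, Matrix.mul_apply,
      Fintype.sum_equiv (Fin.consEquiv fun _ => X).symm _ (fun a => if a.1 = q ∧
        a.2 (Fin.last N) = p then K 0 a.1 (a.2 0) * ∏ m : Fin N,
          K m.succ (a.2 m.castSucc) (a.2 m.succ) else 0), Fintype.sum_prod_type]
    · rw [Finset.sum_eq_single q]
      · simp_rw [← ih, Finset.mul_sum]
        rw [Finset.sum_comm]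
        refine Finset.sum_congr rfl fun h _ => ?_
        rw [Finset.sum_eq_single (h 0)]
        · simp
        · intro b _ hb
          simp [Ne.symm hb]
        · simp
      · intro b _ hb
        simp [hb]
      · simp
    · intro h
      simp only [Fin.consEquiv, Equiv.coe_fn_symm_mk, Fin.prod_univ_succ, Fin.tail]
      rfl

theorem sum_list_prod {M ι : Type*} [Semiring M] [Fintype ι] {N : ℕ} (F : Fin N → ι → M) :
    ∑ f : Fin N → ι, (List.ofFn fun m => F m (f m)).prod
      = (List.ofFn fun m => ∑ j, F m j).prod := by
  classical
  induction N with
  | zero => simp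
  | succ N ih =>
    rw [List.ofFn_succ, List.prod_cons, ← ih,
      Fintype.sum_equiv (Fin.consEquiv fun _ => ι).symm _ (fun a => F 0 a.1 *
        (List.ofFn fun m : Fin N => F m.succ (a.2 m)).prod), Fintype.sum_prod_type,
      Finset.sum_mul_sum]
    intro h
    simp only [Fin.consEquiv, Equiv.coe_fn_symm_mk, List.ofFn_succ, Fin.tail, List.prod_cons]

/-- The train argument: the R-matrix is carried through a whole pair of rows, one column at a time.
-/
theorem list_prod_semiconj {M : Type*} [Monoid M] {N : ℕ} {r : M} {F G : Fin N → M}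
    (h : ∀ m, F m * r = r * G m) : (List.ofFn F).prod * r = r * (List.ofFn G).prod := by
  induction N with
  | zero => simp
  | succ N ih =>
    rw [List.ofFn_succ, List.ofFn_succ, List.prod_cons, List.prod_cons, mul_assoc,
      ih fun m => h m.succ, ← mul_assoc, h, mul_assoc]

theorem list_prod_kronecker {N : ℕ} (F G : Fin N → Matrix X X R) :
    Matrix.kronecker (List.ofFn F).prod (List.ofFn G).prod
      = (List.ofFn fun m => Matrix.kronecker (F m) (G m)).prod := by
  induction N with
  | zero => simp [Matrix.kronecker]
  | succ N ih =>
    rw [List.ofFn_succ, List.ofFn_succ, List.ofFn_succ, List.prod_cons, List.prod_cons,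
      List.prod_cons, ← ih]
    exact Matrix.mul_kronecker_mul _ _ _ _

/-- The outer factors `a` and `b` serve for all `g` at once, so a relation between two adjacent rows
extends to the full grid. -/
theorem exists_list_prod_split {M : Type*} [Monoid M] {n : ℕ} (i : Fin (n - 1)) (f : Fin n → M) :
    ∃ a b : M, ∀ g : Fin n → M, (∀ j, j ≠ lo i → j ≠ hi i → g j = f j) →
      (List.ofFn g).prod = a * (g (lo i) * g (hi i)) * b := by
  have hi' := i.2
  refine ⟨((List.ofFn f).take i).prod, ((List.ofFn f).drop (i + 2)).prod, fun g hg => ?_⟩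
  have h1 : (List.ofFn g).take i = (List.ofFn f).take i := by
    refine List.ext_getElem (by simp) fun k h1 h2 => ?_
    simp only [List.length_take, List.length_ofFn, lt_min_iff] at h1
    simp only [List.getElem_take, List.getElem_ofFn]
    exact hg _ (by simp [lo]; omega) (by simp [hi]; omega)
  have h2 : (List.ofFn g).drop (i + 2) = (List.ofFn f).drop (i + 2) := by
    refine List.ext_getElem (by simp) fun k h1 h2 => ?_
    simp only [List.getElem_drop, List.getElem_ofFn]
    exact hg _ (by simp [lo]; omega) (by simp [hi]; omega)
  rw [← h1, ← h2]
  conv_lhs => rw [← List.take_append_drop i (List.ofFn g)]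
  rw [List.prod_append, List.drop_eq_getElem_cons (by simp; omega),
    List.drop_eq_getElem_cons (by simp; omega)]
  simp only [List.getElem_ofFn, List.prod_cons, mul_assoc]
  rfl

end Paths

/-! ### Row transfer matrices and their exchange relation. -/

section Transfer

variable {A : Type*} [CommRing A] {n : ℕ}

/-- The weights of a vertex with top label `S` and bottom label `T`, as a matrix indexed by the
labels of its right and left edges. -/
def vertexMatrix (α β γ x : A) (S T : Finset (Fin n)) :
    Matrix (Option (Fin n)) (Option (Fin n)) A :=
  Matrix.of fun p a => weight α β γ x a S p T

/-- The partition function of a row with right boundary label `+`, as a matrix indexed by the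
labels of the vertical edges above and below the row. -/
def transfer (N : ℕ) (α β γ x : A) (l : Option (Fin n)) :
    Matrix (Fin (N + 1) → Finset (Fin n)) (Fin (N + 1) → Finset (Fin n)) A :=
  Matrix.of fun V V' => (List.ofFn fun m => vertexMatrix α β γ x (V m) (V' m)).prod none l

/-- The weights of a column of two vertices, as a matrix indexed by the labels of the right and
of the left edges. -/
def twoMatrix (α β γ x y : A) (S T : Finset (Fin n)) :
    Matrix (Option (Fin n) × Option (Fin n)) (Option (Fin n) × Option (Fin n)) A :=
  Matrix.of fun P Q => twoWeight α β γ x y S T P.1 P.2 Q.1 Q.2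

/-- The R-matrix. -/
def rMatrix (α β x u y v : A) :
    Matrix (Option (Fin n) × Option (Fin n)) (Option (Fin n) × Option (Fin n)) A :=
  Matrix.of fun P Q => (if P = Q then rDiag α β x u y v Q.1 Q.2 else 0)
    + (if P = Q.swap then rSwap α β x u y v Q.1 Q.2 else 0)

theorem mul_rMatrix (α β x u y v : A)
    (K : Matrix (Option (Fin n) × Option (Fin n)) (Option (Fin n) × Option (Fin n)) A)
    (P Q : Option (Fin n) × Option (Fin n)) :
    (K * rMatrix (n := n) α β x u y v) P Q
      = K P Q * rDiag α β x u y v Q.1 Q.2 + K P Q.swap * rSwap α β x u y v Q.1 Q.2 := by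
  simp [Matrix.mul_apply, rMatrix, mul_add, Finset.sum_add_distrib]

theorem rMatrix_mul (α β x u y v : A)
    (K : Matrix (Option (Fin n) × Option (Fin n)) (Option (Fin n) × Option (Fin n)) A)
    (P Q : Option (Fin n) × Option (Fin n)) :
    (rMatrix (n := n) α β x u y v * K) P Q
      = rDiag α β x u y v P.1 P.2 * K P Q + rSwap α β x u y v P.2 P.1 * K P.swap Q := by
  have h : ∀ r : Option (Fin n) × Option (Fin n), P = r.swap ↔ P.swap = r := fun r =>
    ⟨fun h => by rw [h, Prod.swap_swap], fun h => by rw [← h, Prod.swap_swap]⟩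
  simp only [Matrix.mul_apply, rMatrix, add_mul, Finset.sum_add_distrib, Matrix.of_apply, h]
  simp

theorem twoMatrix_mul_rMatrix (α β γ x y : A) (S T : Finset (Fin n)) :
    twoMatrix α β γ x y S T * rMatrix α β x (oplusOne α γ x) y (oplusOne α γ y)
      = rMatrix α β x (oplusOne α γ x) y (oplusOne α γ y) * twoMatrix α β γ y x S T := by
  ext P Q
  rw [mul_rMatrix, rMatrix_mul]
  exact twoWeight_ybe α β γ x y S T P.1 P.2 Q.1 Q.2

/-- Two rows are read column by column instead of row by row: the mixed-product rule for Kronecker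
products pairs the vertices of a column, and distributivity moves the sum over the inner vertical
labels into the columns. -/
theorem transfer_mul_apply (N : ℕ) (α β γ x y : A) (a b : Option (Fin n))
    (V V' : Fin (N + 1) → Finset (Fin n)) :
    (transfer N α β γ x a * transfer N α β γ y b) V V'
      = (List.ofFn fun m => twoMatrix α β γ x y (V m) (V' m)).prod (none, none) (a, b) := by
  have key : ∀ m, twoMatrix α β γ x y (V m) (V' m) = ∑ M, Matrix.kronecker
      (vertexMatrix α β γ x (V m) M) (vertexMatrix α β γ y M (V' m)) := by
    intro m
    ext P Q
    simp [twoMatrix, twoWeight, vertexMatrix, Matrix.kronecker, Matrix.sum_apply]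
  simp_rw [key]
  rw [← sum_list_prod, Matrix.mul_apply, Matrix.sum_apply]
  refine Finset.sum_congr rfl fun W _ => ?_
  rw [← list_prod_kronecker]
  rfl

/-- The exchange relation of two adjacent rows with exiting colors `d < c`. -/
theorem transfer_exchange (N : ℕ) (α β γ x y : A) {c d : Fin n} (h : d < c) :
    ((α + β + γ) * x + γ * y + 1 + (β + γ) * (α + γ) * x * y) •
        (transfer N α β γ y (some c) * transfer N α β γ x (some d))
      = (y - x) • (transfer N α β γ x (some d) * transfer N α β γ y (some c))
        + (oplusOne α γ x * oplusOne β γ y) •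
          (transfer N α β γ x (some c) * transfer N α β γ y (some d)) := by
  ext V V'
  have := list_prod_semiconj fun m => twoMatrix_mul_rMatrix α β γ x y (V m) (V' m)
  -- At the right boundary both labels are `+`, where the exchanging R-weight vanishes; so one side
  -- has a single term and the other has two.
  have := congr_fun₂ this (none, none) (some c, some d)
  rw [mul_rMatrix, rMatrix_mul] at this
  simp only [Matrix.add_apply, Matrix.smul_apply, smul_eq_mul, transfer_mul_apply]
  simp only [rDiag, rSwap, Prod.swap_prod_mk, h, h.ne', if_true, if_false, zero_mul, add_zero]
    at this
  have h1 : y * oplusOne α γ x - x * oplusOne α γ y = y - x := by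
    simp only [oplusOne]; ring
  have h2 : oplusOne α γ x * oplusOne α γ y - α * y * oplusOne α γ x + β * x * oplusOne α γ y
      = (α + β + γ) * x + γ * y + 1 + (β + γ) * (α + γ) * x * y := by
    simp only [oplusOne]; ring
  rw [h1, h2, ← oplusOne_eq] at this
  rw [← this]
  ring

/-- The partition function with arbitrary left boundary labels `l`, written with transfer
matrices. -/
def leftZ (N : ℕ) (α β γ : A) (x : Fin n → A) (l : Fin n → Option (Fin n))
    (V V' : Fin (N + 1) → Finset (Fin n)) : A :=
  (List.ofFn fun i => transfer N α β γ (x i) (l i)).prod V V'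

end Transfer

/-! ### Partition functions: exchange relation, change of rings, the constant `C`. -/

section PartitionFunction

variable {A : Type*} [CommRing A] {n : ℕ}

/-- The labels of the top boundary. -/
def topRow (N : ℕ) (w₂ : Equiv.Perm (Fin n)) (μ : Fin n → ℕ) (m : Fin (N + 1)) :
    Finset (Fin n) :=
  (Finset.univ.filter fun i => μ i = m.1).image fun i => (w₂⁻¹ i).rev

/-- Once the vertical labels are fixed, the horizontal labels of different rows are independent, so
the sum over them factors into row partition functions. -/
theorem partitionFn_eq_leftZ (α β γ : A) (x : Fin n → A) (N : ℕ) (w₁ w₂ : Equiv.Perm (Fin n))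
    (μ : Fin n → ℕ) :
    partitionFn α β γ x N w₁ w₂ μ
      = leftZ N α β γ x (fun i => some (w₁⁻¹ i).rev) (topRow N w₂ μ) (fun _ => ∅) := by
  unfold partitionFn leftZ
  rw [← sum_path, Finset.sum_filter, Fintype.sum_prod_type_right]
  refine Finset.sum_congr rfl fun v _ => ?_
  have hrow : ∀ i, transfer N α β γ (x i) (some (w₁⁻¹ i).rev) (v i.castSucc) (v i.succ)
      = ∑ h : Fin (N + 2) → Option (Fin n),
        if h 0 = none ∧ h (Fin.last (N + 1)) = some (w₁⁻¹ i).rev then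
          ∏ m : Fin (N + 1), weight α β γ (x i) (h m.succ) (v i.castSucc m) (h m.castSucc)
            (v i.succ m) else 0 := by
    intro i
    unfold transfer
    rw [Matrix.of_apply, ← sum_path]
    rfl
  simp_rw [hrow]
  rw [Fintype.prod_sum]
  by_cases hv : v 0 = topRow N w₂ μ ∧ v (Fin.last n) = fun _ => ∅
  · rw [if_pos hv]
    refine Finset.sum_congr rfl fun h _ => ?_
    by_cases hb : ∀ i, h i 0 = none ∧ h i (Fin.last (N + 1)) = some (w₁⁻¹ i).rev
    · rw [if_pos, stateWeight]
      · exact Finset.prod_congr rfl fun i _ => (if_pos (hb i)).symm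
      · exact ⟨fun i => (hb i).2, fun i => (hb i).1, fun m => congr_fun hv.1 m,
          fun m => congr_fun hv.2 m⟩
    · rw [if_neg]
      · push Not at hb
        obtain ⟨i, hi⟩ := hb
        exact (Finset.prod_eq_zero (Finset.mem_univ i) (if_neg fun h' => hi h'.1 h'.2)).symm
      · rintro ⟨h1, h2, -, -⟩
        exact hb fun i => ⟨h2 i, h1 i⟩
  · rw [if_neg hv]
    refine Finset.sum_eq_zero fun h _ => if_neg ?_
    rintro ⟨-, -, h3, h4⟩
    exact hv ⟨funext h3, funext h4⟩

theorem lo_ne_hi (i : Fin (n - 1)) : lo i ≠ hi i := by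
  simp [lo, hi, Fin.ext_iff]

theorem leftZ_exchange (α β γ : A) (x : Fin n → A) (N : ℕ) (i : Fin (n - 1)) (l : Fin n → Fin n)
    (h : l (hi i) < l (lo i)) (V V' : Fin (N + 1) → Finset (Fin n)) :
    ((α + β + γ) * x (lo i) + γ * x (hi i) + 1 + (β + γ) * (α + γ) * x (lo i) * x (hi i)) *
        leftZ N α β γ (x ∘ simple i) (fun j => some (l j)) V V'
      = (x (hi i) - x (lo i)) * leftZ N α β γ x (fun j => some (l (simple i j))) V V'
        + (oplusOne α γ (x (lo i)) * oplusOne β γ (x (hi i))) *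
          leftZ N α β γ x (fun j => some (l j)) V V' := by
  have hlo : simple i (lo i) = hi i := Equiv.swap_apply_left _ _
  have hhi : simple i (hi i) = lo i := Equiv.swap_apply_right _ _
  have hne : ∀ j, j ≠ lo i → j ≠ hi i → simple i j = j := fun j h1 h2 =>
    Equiv.swap_apply_of_ne_of_ne h1 h2
  obtain ⟨a, b, hab⟩ := exists_list_prod_split i
    (fun j => transfer N α β γ (x j) (some (l j)))
  unfold leftZ
  rw [hab _ fun j h1 h2 => by simp only [Function.comp_apply, hne j h1 h2],
    hab _ fun j h1 h2 => by simp only [hne j h1 h2], hab _ fun _ _ _ => rfl]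
  simp only [Function.comp_apply, hlo, hhi]
  have := congr_arg (fun M => a * M * b)
    (transfer_exchange N α β γ (x (lo i)) (x (hi i)) h)
  simp only [mul_add, add_mul, Matrix.mul_smul, Matrix.smul_mul] at this
  have := congr_fun₂ this V V'
  simp only [Matrix.add_apply, Matrix.smul_apply, smul_eq_mul] at this
  linear_combination this

theorem partitionFn_exchange (α β γ : A) (x : Fin n → A) (N : ℕ) (i : Fin (n - 1))
    (w w₂ : Equiv.Perm (Fin n)) (μ : Fin n → ℕ) (h : w⁻¹ (lo i) < w⁻¹ (hi i)) :
    ((α + β + γ) * x (lo i) + γ * x (hi i) + 1 + (β + γ) * (α + γ) * x (lo i) * x (hi i)) *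
        partitionFn α β γ (x ∘ simple i) N w w₂ μ
      = (x (hi i) - x (lo i)) * partitionFn α β γ x N (simple i * w) w₂ μ
        + (oplusOne α γ (x (lo i)) * oplusOne β γ (x (hi i))) *
          partitionFn α β γ x N w w₂ μ := by
  simp only [partitionFn_eq_leftZ]
  rw [leftZ_exchange α β γ x N i (fun j => (w⁻¹ j).rev) (Fin.rev_lt_rev.2 h)]
  have : ∀ j, (simple i * w)⁻¹ j = w⁻¹ (simple i j) := fun j => by
    rw [mul_inv_rev, Equiv.Perm.mul_apply, simple, Equiv.swap_inv]
  simp only [this]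

section Map

variable {B : Type*} [CommRing B] (φ : A →+* B)

theorem map_hsym (α β : A) (k : ℤ) : φ (hsym α β k) = hsym (φ α) (φ β) k := by
  unfold hsym
  split_ifs <;> simp

theorem map_abh (α β : A) (k : ℤ) : φ (abh α β k) = abh (φ α) (φ β) k := by
  unfold abh
  split_ifs <;> simp [map_hsym]

theorem map_oplusOne (p γ x : A) : φ (oplusOne p γ x) = oplusOne (φ p) (φ γ) (φ x) := by
  simp [oplusOne]

theorem map_weight (α β γ x : A) (l : Option (Fin n)) (S : Finset (Fin n)) (r : Option (Fin n))
    (T : Finset (Fin n)) :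
    φ (weight α β γ x l S r T) = weight (φ α) (φ β) (φ γ) (φ x) l S r T := by
  rcases l with _ | c <;> rcases r with _ | d <;> simp only [weight] <;> split_ifs <;>
    simp [map_hsym, map_abh, map_oplusOne]

theorem map_partitionFn (α β γ : A) (x : Fin n → A) (N : ℕ) (w₁ w₂ : Equiv.Perm (Fin n))
    (μ : Fin n → ℕ) :
    φ (partitionFn α β γ x N w₁ w₂ μ) = partitionFn (φ α) (φ β) (φ γ) (φ ∘ x) N w₁ w₂ μ := by
  simp [partitionFn, stateWeight, map_weight]

theorem map_normConst (α β γ : A) (μ : Fin n → ℕ) :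
    φ (normConst α β γ μ) = normConst (φ α) (φ β) (φ γ) μ := by
  simp [normConst, map_abh, map_hsym]

end Map

/-- At these values the factor for `j = 1` comes only from `α β h_{-2} = -1`, and that for `j ≥ 2`
only from `h_{j-2}(0, 1) = 1`; so every factor is `±1`. This is the specialization showing that the
generic `C` is nonzero. -/
theorem normConst_zero_one_one (μ : Fin n → ℕ) : normConst (0 : A) 1 1 μ ^ 2 = 1 := by
  rw [normConst, ← Finset.prod_pow]
  refine Finset.prod_eq_one fun p _ => ?_
  rw [← Finset.prod_pow]
  refine Finset.prod_eq_one fun j hj => ?_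
  rw [Finset.mem_Icc] at hj
  obtain ⟨k, rfl⟩ : ∃ k, j = k + 1 := ⟨j - 1, by omega⟩
  have h1 : hsym (0 : A) 1 (((k + 1 : ℕ) : ℤ) - 2) = hPred 0 1 k := by
    rw [hPred]; congr 1; push_cast; ring
  have h2 : abh (0 : A) 1 (((k + 1 : ℕ) : ℤ) - 3) = abhPred 0 1 k := by
    rw [abhPred]; congr 1; push_cast; ring
  rw [h1, h2]
  have h3 : ∀ k, hPred (0 : A) 1 (k + 1) = 1 := by
    intro k
    induction k with
    | zero => simp [hPred_succ]
    | succ k ih => rw [hPred_succ_succ_eq, ih]; simp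
  cases k with
  | zero => simp
  | succ k =>
    rw [abhPred_succ, h3]
    simp only [zero_mul, Nat.add_sub_cancel]
    rw [mul_pow, ← pow_mul, mul_comm _ 2, pow_mul]
    simp

end PartitionFunction

/-! ### Reduced words and minimal sorting permutations. -/

section Words

variable {n : ℕ}

theorem wordPerm_cons (i : Fin (n - 1)) (ω : List (Fin (n - 1))) :
    wordPerm (i :: ω) = simple i * wordPerm ω := by
  simp [wordPerm]

theorem simple_mul_simple (i : Fin (n - 1)) : simple i * simple i = 1 :=
  Equiv.swap_mul_self _ _

theorem simple_inv (i : Fin (n - 1)) : (simple i)⁻¹ = simple i := Equiv.swap_inv _ _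

/-- A simple transposition reverses no pair other than its own. -/
theorem simple_lt_simple {i : Fin (n - 1)} {a b : Fin n} (h : a < b)
    (h' : ¬(a = lo i ∧ b = hi i)) : simple i a < simple i b := by
  simp only [simple, Equiv.swap_apply_def]
  simp only [Fin.lt_def, Fin.ext_iff, lo, hi] at *
  split_ifs <;> first | omega | (dsimp only at *; omega)

/-- The strong exchange condition. -/
theorem exists_shorter_word (ω : List (Fin (n - 1))) {a b : Fin n} (h : a < b)
    (h' : (wordPerm ω)⁻¹ b < (wordPerm ω)⁻¹ a) :
    ∃ ω' : List (Fin (n - 1)), wordPerm ω' = Equiv.swap a b * wordPerm ω ∧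
      ω'.length < ω.length := by
  induction ω generalizing a b with
  | nil =>
    simp only [wordPerm, List.map_nil, List.prod_nil, inv_one, Equiv.Perm.one_apply] at h'
    exact absurd h' h.not_gt
  | cons j ω ih =>
    rw [wordPerm_cons] at h' ⊢
    by_cases hj : a = lo j ∧ b = hi j
    · refine ⟨ω, ?_, by simp⟩
      obtain ⟨rfl, rfl⟩ := hj
      rw [← mul_assoc, show Equiv.swap (lo j) (hi j) = simple j from rfl, simple_mul_simple,
        one_mul]
    · simp only [mul_inv_rev, simple_inv, Equiv.Perm.mul_apply] at h'
      obtain ⟨ω', h1, h2⟩ := ih (simple_lt_simple h hj) h'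
      -- Conjugation by `simple j` turns the transposition of `simple j a`, `simple j b` into that
      -- of `a`, `b`.
      refine ⟨j :: ω', ?_, by simpa using h2⟩
      rw [wordPerm_cons, h1, Equiv.swap_apply_apply, simple_inv, ← mul_assoc, ← mul_assoc,
        ← mul_assoc, simple_mul_simple, one_mul, mul_assoc]

theorem IsReduced.tail {i : Fin (n - 1)} {ω : List (Fin (n - 1))} (h : IsReduced (i :: ω)) :
    IsReduced ω := by
  intro ω' h'
  have := h (i :: ω') (by rw [wordPerm_cons, wordPerm_cons, h'])
  simpa using this

theorem IsReduced.inv_lt {i : Fin (n - 1)} {ω : List (Fin (n - 1))} (h : IsReduced (i :: ω)) :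
    (wordPerm ω)⁻¹ (lo i) < (wordPerm ω)⁻¹ (hi i) := by
  by_contra hlt
  have hne : (wordPerm ω)⁻¹ (hi i) ≠ (wordPerm ω)⁻¹ (lo i) :=
    fun e => lo_ne_hi i ((wordPerm ω)⁻¹.injective e).symm
  obtain ⟨ω', h1, h2⟩ := exists_shorter_word ω (a := lo i) (b := hi i)
    (by simp [lo, hi, Fin.lt_def])
    (lt_of_le_of_ne (not_lt.1 hlt) hne)
  have := h ω' (by rw [h1, wordPerm_cons]; rfl)
  simp at this
  omega

theorem wordPerm_redWord (w : Equiv.Perm (Fin n)) : wordPerm (redWord w) = w :=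
  (exists_reduced w).choose_spec.1

theorem isReduced_redWord (w : Equiv.Perm (Fin n)) : IsReduced (redWord w) :=
  (exists_reduced w).choose_spec.2

theorem len_wordPerm_le (ω : List (Fin (n - 1))) : len (wordPerm ω) ≤ ω.length :=
  isReduced_redWord _ _ (wordPerm_redWord _).symm

/-- Otherwise exchanging the values `v a` and `v b` would still sort `ζ`, and strong exchange would
make the permutation shorter. -/
theorem IsMinSorter.lt_of_lt {ζ : Fin n → ℕ} {v : Equiv.Perm (Fin n)} (h : IsMinSorter ζ v)
    {a b : Fin n} (hab : a < b) (hζ : plus ζ a = plus ζ b) : v a < v b := by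
  by_contra hlt
  have hlt : v b < v a := lt_of_le_of_ne (not_lt.1 hlt) fun e => hab.ne' (v.injective e)
  obtain ⟨ω, h1, h2⟩ := exists_shorter_word (redWord v) hlt (by simpa [wordPerm_redWord])
  rw [wordPerm_redWord] at h1
  have h3 : ∀ i, ζ (wordPerm ω i) = plus ζ i := by
    intro i
    rw [h1, Equiv.Perm.mul_apply, Equiv.swap_apply_def]
    split_ifs with h4 h5
    · rw [h.1, v.injective h4, hζ]
    · rw [h.1, v.injective h5, hζ]
    · exact h.1 i
  have h4 := h.2 _ h3
  have h5 := len_wordPerm_le ω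
  have h6 : len v = (redWord v).length := rfl
  omega

/-- Two sorters increasing on the blocks of `ζ⁺` agree. At a first difference `a` with `v a < u a`,
the permutation `u` would take the value `v a` later in the block of `a`, against monotonicity. -/
theorem IsMinSorter.unique {ζ : Fin n → ℕ} {u v : Equiv.Perm (Fin n)} (hu : IsMinSorter ζ u)
    (hv : IsMinSorter ζ v) : u = v := by
  have key : ∀ {u v : Equiv.Perm (Fin n)}, IsMinSorter ζ u → IsMinSorter ζ v → ∀ a,
      (∀ b < a, u b = v b) → ¬ v a < u a := by
    intro u v hu hv a ih hlt
    have h1 : plus ζ (u⁻¹ (v a)) = plus ζ a := by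
      rw [← hu.1, ← hv.1]; simp
    rcases lt_trichotomy (u⁻¹ (v a)) a with h | h | h
    · have := ih _ h
      rw [show u (u⁻¹ (v a)) = v a by simp] at this
      exact h.ne (v.injective this).symm
    · rw [Equiv.Perm.inv_eq_iff_eq] at h
      exact hlt.ne h
    · have := hu.lt_of_lt h h1.symm
      rw [show u (u⁻¹ (v a)) = v a by simp] at this
      exact lt_asymm hlt this
  ext a
  congr 1
  induction a using WellFoundedLT.induction with
  | ind a ih =>
    exact le_antisymm (not_lt.1 (key hu hv a ih))
      (not_lt.1 (key hv hu a fun b hb => (ih b hb).symm))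

theorem isMinSorter_vPerm (ζ : Fin n → ℕ) : IsMinSorter ζ (vPerm ζ) :=
  (exists_minSorter ζ).choose_spec

theorem isMinSorter_iff {ζ : Fin n → ℕ} {u : Equiv.Perm (Fin n)} :
    IsMinSorter ζ u ↔ u = vPerm ζ :=
  ⟨fun h => h.unique (isMinSorter_vPerm ζ), fun h => h ▸ isMinSorter_vPerm ζ⟩

end Words

open MvPolynomial

/-! ### Kirillov's operators over rings, acting on partition functions. -/

section Generic

variable {R : Type*} [CommRing R] {n : ℕ}

/-- Coefficient rings are needed here because the generic parameters live in `F[α, β, γ]`, which is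
not a field. -/
theorem hi_sub_lo_dvd (i : Fin (n - 1)) (f : MvPolynomial (Fin n) R) :
    (X (hi i) - X (lo i) : MvPolynomial (Fin n) R) ∣ rename (simple i) f - f := by
  induction f using MvPolynomial.induction_on with
  | C a => simp
  | add p q hp hq =>
    rw [map_add, add_sub_add_comm]; exact dvd_add hp hq
  | mul_X p j hp =>
    have hX : (X (hi i) - X (lo i) : MvPolynomial (Fin n) R) ∣ X (simple i j) - X j := by
      unfold simple
      by_cases h1 : j = lo i
      · subst h1; simp
      · by_cases h2 : j = hi i
        · subst h2
          rw [Equiv.swap_apply_right, ← neg_sub (X (hi i)) (X (lo i)), dvd_neg]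
        · rw [Equiv.swap_apply_of_ne_of_ne h1 h2]; simp
    have : rename (simple i) (p * X j) - p * X j
        = (rename (simple i) p - p) * X (simple i j) + p * (X (simple i j) - X j) := by
      rw [map_mul, rename_X]; ring
    rw [this]
    exact dvd_add (hp.mul_right _) (hX.mul_left _)

/-- The divided difference over a commutative ring. -/
noncomputable def domDivDiff (i : Fin (n - 1)) (f : MvPolynomial (Fin n) R) :
    MvPolynomial (Fin n) R := (hi_sub_lo_dvd i f).choose

theorem domDivDiff_spec (i : Fin (n - 1)) (f : MvPolynomial (Fin n) R) :
    (X (hi i) - X (lo i)) * domDivDiff i f = rename (simple i) f - f :=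
  (hi_sub_lo_dvd i f).choose_spec.symm

/-- Kirillov's operator over a commutative ring. -/
noncomputable def domKirOp (α β γ : R) (i : Fin (n - 1)) (f : MvPolynomial (Fin n) R) :
    MvPolynomial (Fin n) R :=
  -(C β) * f + (C (α + β + γ) * X (lo i) + C γ * X (hi i) + 1
    + C ((β + γ) * (α + γ)) * X (lo i) * X (hi i)) * domDivDiff i f

/-- The composition of Kirillov's operators along a word over a commutative ring. -/
noncomputable def domWordOp (α β γ : R) (ω : List (Fin (n - 1))) (f : MvPolynomial (Fin n) R) :
    MvPolynomial (Fin n) R := ω.foldr (domKirOp α β γ) f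

/-- With `Q` the polynomial in front of `∂_i`, the sum `Q + β (x_{i+1} - x_i)` factors as `(1 + (α +
γ) x_i)(1 + (β + γ) x_{i+1})`. Over a domain this equation determines the operator, and it has the
shape of `partitionFn_exchange`. -/
theorem domKirOp_spec (α β γ : R) (i : Fin (n - 1)) (f : MvPolynomial (Fin n) R) :
    (X (hi i) - X (lo i)) * domKirOp α β γ i f
      = (C (α + β + γ) * X (lo i) + C γ * X (hi i) + 1
        + C ((β + γ) * (α + γ)) * X (lo i) * X (hi i)) * rename (simple i) f
        - oplusOne (C α) (C γ) (X (lo i)) * oplusOne (C β) (C γ) (X (hi i)) * f := by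
  have := domDivDiff_spec i f
  simp only [domKirOp, oplusOne, map_add, map_mul] at *
  linear_combination ((C α + C β + C γ) * X (lo i) + C γ * X (hi i) + 1
        + ((C β + C γ) * (C α + C γ)) * X (lo i) * X (hi i)) * this

theorem kirOp_spec {F : Type*} [Field F] (α β γ : F) (i : Fin (n - 1))
    (f : MvPolynomial (Fin n) F) :
    (X (hi i) - X (lo i)) * kirOp α β γ i f
      = (C (α + β + γ) * X (lo i) + C γ * X (hi i) + 1
        + C ((β + γ) * (α + γ)) * X (lo i) * X (hi i)) * rename (simple i) f
        - oplusOne (C α) (C γ) (X (lo i)) * oplusOne (C β) (C γ) (X (hi i)) * f := by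
  have := divDiff_spec i f
  simp only [kirOp, oplusOne, map_add, map_mul] at *
  linear_combination ((C α + C β + C γ) * X (lo i) + C γ * X (hi i) + 1
        + ((C β + C γ) * (C α + C γ)) * X (lo i) * X (hi i)) * this

theorem hi_sub_lo_ne_zero [IsDomain R] (i : Fin (n - 1)) :
    (X (hi i) - X (lo i) : MvPolynomial (Fin n) R) ≠ 0 :=
  sub_ne_zero.2 fun h => lo_ne_hi i (X_injective h).symm

theorem map_domKirOp {F : Type*} [Field F] (φ : R →+* F) (α β γ : R) (i : Fin (n - 1))
    (f : MvPolynomial (Fin n) R) :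
    map φ (domKirOp α β γ i f) = kirOp (φ α) (φ β) (φ γ) i (map φ f) := by
  refine mul_left_cancel₀ (hi_sub_lo_ne_zero i) ?_
  have := congr_arg (map φ) (domKirOp_spec α β γ i f)
  rw [kirOp_spec]
  simpa [oplusOne, map_rename] using this

theorem map_domWordOp {F : Type*} [Field F] (φ : R →+* F) (α β γ : R) (ω : List (Fin (n - 1)))
    (f : MvPolynomial (Fin n) R) :
    map φ (domWordOp α β γ ω f) = wordOp (φ α) (φ β) (φ γ) ω (map φ f) := by
  induction ω with
  | nil => rfl
  | cons i ω ih =>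
    simp only [domWordOp, wordOp, List.foldr_cons] at *
    rw [map_domKirOp, ih]

variable [IsDomain R]

theorem domKirOp_C_mul (α β γ c : R) (i : Fin (n - 1)) (f : MvPolynomial (Fin n) R) :
    domKirOp α β γ i (C c * f) = C c * domKirOp α β γ i f := by
  refine mul_left_cancel₀ (hi_sub_lo_ne_zero i) ?_
  rw [domKirOp_spec, mul_left_comm (X (hi i) - X (lo i)), domKirOp_spec,
    map_mul (rename _), rename_C]
  ring

/-- The partition function with spectral parameters `X`. -/
noncomputable def polyZ (α β γ : R) (N : ℕ) (w₁ w₂ : Equiv.Perm (Fin n)) (μ : Fin n → ℕ) :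
    MvPolynomial (Fin n) R :=
  partitionFn (C α) (C β) (C γ) X N w₁ w₂ μ

theorem domKirOp_polyZ (α β γ : R) (N : ℕ) (i : Fin (n - 1)) (w w₂ : Equiv.Perm (Fin n))
    (μ : Fin n → ℕ) (h : w⁻¹ (lo i) < w⁻¹ (hi i)) :
    domKirOp α β γ i (polyZ α β γ N w w₂ μ) = polyZ α β γ N (simple i * w) w₂ μ := by
  refine mul_left_cancel₀ (hi_sub_lo_ne_zero i) ?_
  have h1 := partitionFn_exchange (C α) (C β) (C γ) (X : Fin n → MvPolynomial (Fin n) R) N i w w₂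
    μ h
  have h2 : rename (simple i) (polyZ α β γ N w w₂ μ)
      = partitionFn (C α) (C β) (C γ) ((X : Fin n → MvPolynomial (Fin n) R) ∘ simple i) N w w₂
        μ := by
    have := map_partitionFn (rename (simple i) : MvPolynomial (Fin n) R →ₐ[R] _).toRingHom
      (C α) (C β) (C γ) X N w w₂ μ
    simp only [AlgHom.toRingHom_eq_coe, RingHom.coe_coe, rename_C] at this
    rw [polyZ, this]
    congr 1
    ext j : 1
    simp
  rw [domKirOp_spec, h2]
  simp only [polyZ, map_add, map_mul]
  linear_combination h1

/-- Reducedness guarantees that each letter increases the length, which is the order condition of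
the exchange relation (`IsReduced.inv_lt`). -/
theorem domWordOp_polyZ (α β γ c : R) (N : ℕ) (w₂ : Equiv.Perm (Fin n)) (μ : Fin n → ℕ)
    (f : MvPolynomial (Fin n) R) (h : C c * f = polyZ α β γ N 1 w₂ μ) (ω : List (Fin (n - 1)))
    (hω : IsReduced ω) :
    C c * domWordOp α β γ ω f = polyZ α β γ N (wordPerm ω) w₂ μ := by
  induction ω with
  | nil => exact h
  | cons i ω ih =>
    have := ih hω.tail
    rw [wordPerm_cons, ← domKirOp_polyZ _ _ _ _ _ _ _ _ hω.inv_lt, ← this, domKirOp_C_mul]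
    rfl

end Generic

/-! ### Symmetric factors commute with the operators. -/

section Symmetric

variable {F : Type*} [Field F] {n : ℕ}

theorem kirOp_mul (α β γ : F) (i : Fin (n - 1)) {s : MvPolynomial (Fin n) F}
    (hs : rename (simple i) s = s) (f : MvPolynomial (Fin n) F) :
    kirOp α β γ i (s * f) = s * kirOp α β γ i f := by
  refine mul_left_cancel₀ (hi_sub_lo_ne_zero i) ?_
  rw [kirOp_spec, mul_left_comm (X (hi i) - X (lo i)), kirOp_spec, map_mul (rename _), hs]
  ring

theorem wordOp_mul (α β γ : F) (ω : List (Fin (n - 1))) {s : MvPolynomial (Fin n) F}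
    (hs : s.IsSymmetric) (f : MvPolynomial (Fin n) F) :
    wordOp α β γ ω (s * f) = s * wordOp α β γ ω f := by
  induction ω with
  | nil => rfl
  | cons i ω ih =>
    simp only [wordOp, List.foldr_cons] at *
    rw [ih, kirOp_mul _ _ _ _ (hs (simple i))]

theorem isSymmetric_prod_X_pow (k : ℕ) :
    ((∏ i, X i : MvPolynomial (Fin n) F) ^ k).IsSymmetric := by
  intro e
  rw [map_pow, map_prod]
  simp only [rename_X]
  rw [Equiv.prod_comp e fun i => (X i : MvPolynomial (Fin n) F)]

end Symmetric

/-! ### The unique state for the identity permutation. -/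

section Ground

variable {A : Type*} [CommRing A] {n : ℕ}

/-- The weight of a vertex at which the largest of `k` colors leaves the column. -/
def exitWeight (α β γ : A) (k : ℕ) : A :=
  (-1) ^ k * (abh α β ((k : ℤ) - 3) + γ * hsym α β ((k : ℤ) - 2))

theorem above_eq_zero {c : Fin n} {S : Finset (Fin n)} (h : ∀ d ∈ S, d ≤ c) : above c S = 0 := by
  unfold above
  rw [Finset.card_eq_zero, Finset.filter_eq_empty_iff]
  exact fun d hd => not_lt.2 (h d hd)

/-- Colors run from the top and right edges to the left and bottom ones. Left of column `m₀` no top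
label contains `c`, so the exiting `c` is forced back to `m₀`; right of it the columns are empty and
only `+` can pass. Each of the `N - m₀` columns on the left contributes `x`, since no color exceeds
`c`. -/
theorem transfer_ground (N : ℕ) (α β γ x : A) {c : Fin n} {V : Fin (N + 1) → Finset (Fin n)}
    {m₀ : Fin (N + 1)} (hc : c ∈ V m₀) (hmax : ∀ m, ∀ d ∈ V m, d ≤ c)
    (hlt : ∀ m < m₀, V m = ∅) (hgt : ∀ m, m₀ < m → c ∉ V m) (V' : Fin (N + 1) → Finset (Fin n)) :
    transfer N α β γ x (some c) V V'
      = if V' = Function.update V m₀ ((V m₀).erase c) then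
          exitWeight α β γ (V m₀).card * x ^ (N - m₀.1) else 0 := by
  -- The value `1` comes from the convention `α β h_{-2} = -1`.
  have hempty : ∀ B, weight α β γ x none (∅ : Finset (Fin n)) none B = if B = ∅ then 1 else 0 := by
    intro B; simp [weight, hsym, abh]
  have hexit : ∀ B, weight α β γ x (some c) (V m₀) none B
      = if B = (V m₀).erase c then exitWeight α β γ (V m₀).card else 0 := by
    intro B
    simp [weight, hc, above_eq_zero (hmax m₀), exitWeight]
  have hpass : ∀ m, m₀ < m → ∀ B, weight α β γ x (some c) (V m) (some c) B
      = if B = V m then x else 0 := by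
    intro m hm B
    simp [weight, hgt m hm, above_eq_zero (hmax m)]
  unfold transfer
  -- Edge `0` is the rightmost one, and the edges beyond `m₀.castSucc` are those left of column
  -- `m₀`.
  rw [Matrix.of_apply, ← sum_path, Finset.sum_eq_single
    (fun j : Fin (N + 1 + 1) => if m₀.castSucc < j then some c else none)]
  · rw [if_pos (by simp [Fin.lt_def, m₀.2])]
    simp only [vertexMatrix, Matrix.of_apply]
    have hfac : ∀ m : Fin (N + 1),
        weight α β γ x (if m₀.castSucc < m.succ then some c else none) (V m)
          (if m₀.castSucc < m.castSucc then some c else none) (V' m)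
        = if V' m = Function.update V m₀ ((V m₀).erase c) m then
          (if m₀ < m then x else if m = m₀ then exitWeight α β γ (V m₀).card else 1) else 0 := by
      intro m
      rcases lt_trichotomy m m₀ with h | rfl | h
      · have h1 : ¬ m₀.castSucc < m.succ := by
          simp only [Fin.lt_def, Fin.le_def, Fin.val_succ, Fin.val_castSucc] at *; omega
        have h2 : ¬ m₀.castSucc < m.castSucc := by
          simp only [Fin.lt_def, Fin.le_def, Fin.val_succ, Fin.val_castSucc] at *; omega
        rw [if_neg h1, if_neg h2, Function.update_of_ne h.ne, hlt m h, hempty]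
        simp [h.not_gt, h.ne]
      · simp only [Function.update_self, lt_irrefl, if_false, Fin.castSucc_lt_succ, if_true]
        exact hexit _
      · have h1 : m₀.castSucc < m.succ := by
          simp only [Fin.lt_def, Fin.le_def, Fin.val_succ, Fin.val_castSucc] at *; omega
        have h2 : m₀.castSucc < m.castSucc := by
          simp only [Fin.lt_def, Fin.le_def, Fin.val_succ, Fin.val_castSucc] at *; omega
        rw [if_pos h1, if_pos h2, Function.update_of_ne h.ne', hpass m h]
        simp [h]
    simp only [hfac]
    by_cases hV : V' = Function.update V m₀ ((V m₀).erase c)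
    · subst hV
      simp only [if_true]
      rw [Finset.prod_ite, Finset.prod_const, mul_comm]
      congr 1
      · rw [Finset.prod_ite_eq' _ m₀]
        simp
      · congr 1
        have : (Finset.univ.filter fun m => m₀ < m) = Finset.Ioi m₀ := by ext; simp
        rw [this, Fin.card_Ioi]
        omega
    · rw [if_neg hV]
      obtain ⟨m, hm⟩ := Function.ne_iff.1 hV
      exact Finset.prod_eq_zero (Finset.mem_univ m) (if_neg hm)
  · intro h _ hne
    split_ifs with hb
    swap; · rfl
    by_contra hprod
    have hw : ∀ m : Fin (N + 1), weight α β γ x (h m.succ) (V m) (h m.castSucc) (V' m) ≠ 0 :=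
      fun m hm => hprod (Finset.prod_eq_zero (Finset.mem_univ m) hm)
    apply hne
    have hright : ∀ j : Fin (N + 1 + 1), j ≤ m₀.castSucc → h j = none := by
      intro j
      induction j using Fin.induction with
      | zero => exact fun _ => hb.1
      | succ m ih =>
        intro hj
        have hm : m < m₀ := by
          simp only [Fin.lt_def, Fin.le_def, Fin.val_succ, Fin.val_castSucc] at *; omega
        have h1 := hw m
        rw [hlt m hm, ih (by
          simp only [Fin.lt_def, Fin.le_def, Fin.val_succ, Fin.val_castSucc] at *; omega)] at h1
        rcases hh : h m.succ with _ | d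
        · rfl
        · rw [hh] at h1
          simp [weight] at h1
    have hleft : ∀ j : Fin (N + 1 + 1), m₀.castSucc < j → h j = some c := by
      intro j
      induction j using Fin.reverseInduction with
      | last => exact fun _ => hb.2
      | cast m ih =>
        intro hj
        have hm : m₀ < m := by simpa using hj
        have h1 := hw m
        rw [ih (by
          simp only [Fin.lt_def, Fin.le_def, Fin.val_succ, Fin.val_castSucc] at *; omega)] at h1
        rcases hh : h m.castSucc with _ | d
        · rw [hh] at h1
          simp [weight, hgt m hm] at h1
        · rw [hh] at h1
          by_cases hcd : c = d
          · rw [hcd]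
          · simp [weight, hgt m hm, hcd] at h1
    ext1 j
    by_cases hj : m₀.castSucc < j
    · rw [if_pos hj, hleft j hj]
    · rw [if_neg hj, hright j (not_lt.1 hj)]
  · simp

theorem list_prod_chain {X R : Type*} [Fintype X] [DecidableEq X] [CommSemiring R] {n : ℕ}
    (T : Fin n → Matrix X X R) (V : Fin (n + 1) → X) (t : Fin n → R)
    (h : ∀ k W, T k (V k.castSucc) W = if W = V k.succ then t k else 0) :
    (List.ofFn T).prod (V 0) (V (Fin.last n)) = ∏ k, t k := by
  induction n with
  | zero => simp
  | succ n ih =>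
    have := ih (fun k => T k.succ) (fun k => V k.succ) (fun k => t k.succ) fun k W => h k.succ W
    rw [List.ofFn_succ, List.prod_cons, Matrix.mul_apply, Fin.prod_univ_succ, ← this,
      Finset.sum_eq_single (V (Fin.succ 0))]
    · have h0 := h 0 (V (Fin.succ 0))
      rw [if_pos rfl] at h0
      exact congr_arg₂ _ h0 rfl
    · intro W _ hW
      have h0 := h 0 W
      rw [if_neg hW] at h0
      exact mul_eq_zero_of_left h0 _
    · simp

/-- Ranks within `S` run once through `1, …, |S|`. In the ground state the rank of `c` among the
colors of its column is the number still present when `c` leaves. -/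
theorem prod_rank {M : Type*} [CommMonoid M] (g : ℕ → M) (S : Finset (Fin n)) :
    ∏ c ∈ S, g (S.filter fun d => d ≤ c).card = ∏ j ∈ Finset.Icc 1 S.card, g j := by
  induction S using Finset.induction_on_max with
  | empty => simp
  | insert a S ha ih =>
    have hn : a ∉ S := fun h => lt_irrefl _ (ha a h)
    rw [Finset.prod_insert hn, Finset.card_insert_of_notMem hn, Finset.prod_Icc_succ_top (by omega),
      ← ih, mul_comm]
    congr 1
    · refine Finset.prod_congr rfl fun c hc => ?_
      rw [Finset.filter_insert, if_neg (not_le.2 (ha c hc))]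
    · rw [Finset.filter_true_of_mem, Finset.card_insert_of_notMem hn]
      intro d hd
      rcases Finset.mem_insert.1 hd with rfl | hd
      · exact le_rfl
      · exact (ha d hd).le

theorem prod_exitWeight (α β γ : A) (μ : Fin n → ℕ) :
    ∏ c, exitWeight α β γ (Finset.univ.filter fun d => μ d = μ c ∧ d ≤ c).card
      = normConst α β γ μ := by
  rw [← Finset.prod_fiberwise_of_maps_to (g := μ) (t := Finset.univ.image μ)
    fun c _ => Finset.mem_image_of_mem μ (Finset.mem_univ c)]
  refine Finset.prod_congr rfl fun p _ => ?_
  have : ∀ j ∈ Finset.Icc 1 (Finset.univ.filter fun i => μ i = p).card,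
      (-1) ^ (j - 1) * (-abh α β ((j : ℤ) - 3) - γ * hsym α β ((j : ℤ) - 2))
        = exitWeight α β γ j := by
    intro j hj
    rw [Finset.mem_Icc] at hj
    obtain ⟨k, rfl⟩ : ∃ k, j = k + 1 := ⟨j - 1, by omega⟩
    rw [exitWeight, Nat.add_sub_cancel, pow_succ]
    ring
  rw [Finset.prod_congr rfl this, ← prod_rank]
  refine Finset.prod_congr rfl fun c hc => ?_
  rw [Finset.filter_filter, (Finset.mem_filter.1 hc).2]

/-- The labels of the vertical edges of the only state with non-zero weight for `w₁ = 1`. -/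
def groundRow (N : ℕ) (μ : Fin n → ℕ) (k : Fin (n + 1)) (m : Fin (N + 1)) : Finset (Fin n) :=
  Finset.univ.filter fun c => μ c = m.1 ∧ c.1 + k.1 < n

/-- Colors leave in decreasing order, one per row. As `μ` is decreasing, the largest remaining color
sits in the rightmost nonempty column, so `transfer_ground` applies to every row. -/
theorem partitionFn_one (α β γ : A) (x : Fin n → A) (N : ℕ) {μ : Fin n → ℕ} (hμ : Antitone μ)
    (hN : ∀ i, μ i ≤ N) :
    partitionFn α β γ x N 1 longPerm μ = normConst α β γ μ * ∏ k, x k ^ (N - μ k.rev) := by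
  have htop : topRow N longPerm μ = groundRow N μ 0 := by
    ext m c
    simp [topRow, groundRow, longPerm]
  have hbot : (fun _ => ∅) = groundRow N μ (Fin.last n) := by
    ext m c
    simp [groundRow]
  rw [partitionFn_eq_leftZ, htop, hbot, leftZ, list_prod_chain (t := fun k =>
    exitWeight α β γ (Finset.univ.filter fun d => μ d = μ k.rev ∧ d ≤ k.rev).card *
      x k ^ (N - μ k.rev)), Finset.prod_mul_distrib, ← prod_exitWeight]
  · congr 1
    exact Equiv.prod_comp Fin.revPerm fun c =>
      exitWeight α β γ (Finset.univ.filter fun d => μ d = μ c ∧ d ≤ c).card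
  · intro k W
    have hk := k.2
    set m₀ : Fin (N + 1) := ⟨μ k.rev, Nat.lt_succ_of_le (hN _)⟩ with hm₀
    have hmem : ∀ m d, d ∈ groundRow N μ k.castSucc m ↔ μ d = m.1 ∧ d ≤ k.rev := by
      intro m d
      simp only [groundRow, Finset.mem_filter, Finset.mem_univ, true_and, Fin.val_castSucc,
        Fin.le_def, Fin.val_rev]
      refine and_congr_right fun _ => ?_
      omega
    have hmem' : ∀ m d, d ∈ groundRow N μ k.succ m ↔ μ d = m.1 ∧ d < k.rev := by
      intro m d
      simp only [groundRow, Finset.mem_filter, Finset.mem_univ, true_and, Fin.val_succ,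
        Fin.lt_def, Fin.val_rev]
      refine and_congr_right fun _ => ?_
      omega
    have hcard : (groundRow N μ k.castSucc m₀)
        = Finset.univ.filter fun d => μ d = μ k.rev ∧ d ≤ k.rev := by
      ext d
      rw [hmem]
      simp [hm₀]
    have hupd : Function.update (groundRow N μ k.castSucc) m₀
        ((groundRow N μ k.castSucc m₀).erase k.rev) = groundRow N μ k.succ := by
      ext m d
      rw [hmem']
      by_cases hm : m = m₀
      · subst hm
        rw [Function.update_self, Finset.mem_erase, hmem, lt_iff_le_and_ne]
        tauto
      · rw [Function.update_of_ne hm, hmem, lt_iff_le_and_ne]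
        have : μ d = m.1 → d ≠ k.rev := by
          rintro h rfl
          exact hm (Fin.ext h.symm)
        tauto
    simp only [inv_one, Equiv.Perm.one_apply]
    rw [transfer_ground N α β γ (x k) (m₀ := m₀), hupd, hcard]
    · rw [hmem]; exact ⟨rfl, le_rfl⟩
    · exact fun m d hd => ((hmem m d).1 hd).2
    · intro m hm
      rw [Finset.eq_empty_iff_forall_notMem]
      intro d hd
      rw [hmem] at hd
      have := hμ hd.2
      rw [hd.1] at this
      exact absurd hm (not_lt.2 this)
    · intro m hm hd
      rw [hmem] at hd
      exact hm.ne (Fin.ext hd.1)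

end Ground

/-! ### Genericity of `C`, independence of the reduced word, and the corollary. -/

section Main

variable {n : ℕ}

theorem normConst_X_ne_zero {R : Type*} [CommRing R] [Nontrivial R] (μ : Fin n → ℕ) :
    normConst (X 0 : MvPolynomial (Fin 3) R) (X 1) (X 2) μ ≠ 0 := by
  intro h
  have h1 := map_normConst (eval ![(0 : R), 1, 1]) (X 0) (X 1) (X 2) μ
  rw [h, map_zero] at h1
  simp only [eval_X, Matrix.cons_val_zero, Matrix.cons_val_one, Matrix.cons_val] at h1
  have h2 := normConst_zero_one_one (A := R) μ
  rw [← h1] at h2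
  simp at h2

theorem normConst_ne_zero {F : Type*} [Field F] {α β γ : F}
    (h : AlgebraicIndependent ℤ ![α, β, γ]) (μ : Fin n → ℕ) : normConst α β γ μ ≠ 0 := by
  have h1 := map_normConst (aeval ![α, β, γ] : MvPolynomial (Fin 3) ℤ →ₐ[ℤ] F).toRingHom
    (X 0) (X 1) (X 2) μ
  simp only [AlgHom.toRingHom_eq_coe, RingHom.coe_coe, aeval_X, Matrix.cons_val_zero,
    Matrix.cons_val_one, Matrix.cons_val] at h1
  rw [← h1]
  intro h2
  exact normConst_X_ne_zero μ (h (h2.trans (map_zero _).symm))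

theorem muOf_antitone [NeZero n] (ζ : Fin n → ℕ) : Antitone (muOf ζ) := fun i j h => by
  have := plus_antitone ζ (Fin.rev_le_rev.2 h)
  unfold muOf
  omega

theorem normConst_mul_domWordOp {R : Type*} [CommRing R] [IsDomain R] [NeZero n] (α β γ : R)
    (ζ : Fin n → ℕ) {ω : List (Fin (n - 1))} (hω : IsReduced ω) :
    C (normConst α β γ (muOf ζ)) * domWordOp α β γ ω (∏ i, X i ^ plus ζ i)
      = polyZ α β γ (plus ζ 0) (wordPerm ω) longPerm (muOf ζ) := by
  refine domWordOp_polyZ α β γ _ _ _ _ _ ?_ ω hω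
  rw [polyZ, partitionFn_one _ _ _ _ _ (muOf_antitone ζ) (fun i => Nat.sub_le _ _),
    map_normConst]
  congr 1
  refine Finset.prod_congr rfl fun i _ => ?_
  have := plus_antitone ζ (Fin.zero_le i)
  simp only [muOf, Fin.rev_rev]
  congr 1
  omega

variable {F : Type*} [Field F]

theorem map_monomial_eq_xPow {R : Type*} [CommRing R] (φ : R →+* F) (d : Fin n → ℕ) :
    map φ (∏ i, X i ^ d i) = xPow F d := by
  simp [xPow]

theorem wordOp_eq_of_isReduced [NeZero n] (α β γ : F) (ζ : Fin n → ℕ)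
    {ω ω' : List (Fin (n - 1))} (hω : IsReduced ω) (hω' : IsReduced ω')
    (h : wordPerm ω = wordPerm ω') :
    wordOp α β γ ω (xPow F (plus ζ)) = wordOp α β γ ω' (xPow F (plus ζ)) := by
  have h1 := normConst_mul_domWordOp (X 0 : MvPolynomial (Fin 3) F) (X 1) (X 2) ζ hω
  rw [h, ← normConst_mul_domWordOp _ _ _ ζ hω'] at h1
  -- The constant is cancelled over `F[α, β, γ]`, where it is nonzero even if its value at the given
  -- parameters vanishes; evaluation comes afterwards.
  have h2 := mul_left_cancel₀
    ((map_ne_zero_iff C (C_injective _ _)).2 (normConst_X_ne_zero _)) h1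
  have h3 := congr_arg (map (eval ![α, β, γ])) h2
  simpa [map_domWordOp, map_monomial_eq_xPow, -map_prod] using h3

theorem normConst_mul_wordOp [NeZero n] (α β γ : F) (ζ : Fin n → ℕ)
    {ω : List (Fin (n - 1))} (hω : IsReduced ω) :
    C (normConst α β γ (muOf ζ)) * wordOp α β γ ω (xPow F (plus ζ))
      = polyZ α β γ (plus ζ 0) (wordPerm ω) longPerm (muOf ζ) := by
  rw [← normConst_mul_domWordOp α β γ ζ hω, ← map_monomial_eq_xPow (RingHom.id F)]
  have := map_domWordOp (RingHom.id F) α β γ ω (∏ i, X i ^ plus ζ i)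
  simp only [map_id, RingHom.id_apply] at this ⊢
  rw [this]

/-- Substituting `λ = μ - ρ` cancels the staircase: `d_i = μ_1 - μ_{n+1-i} = ζ⁺_i - ζ⁺_n`.
Monotonicity of `lam` keeps the natural subtraction from truncating. -/
theorem knExp_add [NeZero n] {ζ lam : Fin n → ℕ} (hlam : Antitone lam)
    (h : ∀ i, lam i + rho i = muOf ζ i) (i : Fin n) :
    plus ζ i = plus ζ (Fin.rev 0) + knExp lam i := by
  have h1 := h 0
  have h2 := h i.rev
  have h3 := hlam (Fin.zero_le i.rev)
  have h4 : plus ζ (Fin.rev 0) ≤ plus ζ i :=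
    plus_antitone ζ (by simp only [Fin.le_def, Fin.val_rev, Fin.val_zero]; omega)
  have h5 : plus ζ i ≤ plus ζ 0 := plus_antitone ζ (Fin.zero_le i)
  have h6 := i.2
  simp only [muOf, rho, knExp, Fin.rev_rev, Fin.val_rev, Fin.val_zero] at *
  omega

theorem xPow_plus [NeZero n] {ζ lam : Fin n → ℕ} (hlam : Antitone lam)
    (h : ∀ i, lam i + rho i = muOf ζ i) :
    xPow F (plus ζ) = (∏ i, X i) ^ plus ζ (Fin.rev 0) * xPow F (knExp lam) := by
  rw [xPow, xPow, ← Finset.prod_pow, ← Finset.prod_mul_distrib]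
  exact Finset.prod_congr rfl fun i _ => by rw [knExp_add hlam h i, pow_add]

end Main

end KeyLattice

theorem theorem4p1 {F : Type*} [Field F] (α β γ : F) {n : ℕ} [NeZero n] (ζ : Fin n → ℕ) :
    -- `v_ζ` is the unique permutation of minimal length with `v_ζ · ζ = ζ⁺`
    (∀ u : Equiv.Perm (Fin n), KeyLattice.IsMinSorter ζ u ↔ u = KeyLattice.vPerm ζ) ∧
    -- `K_ζ` may be computed along any reduced word of `v_ζ`
    (∀ ω : List (Fin (n - 1)), KeyLattice.wordPerm ω = KeyLattice.vPerm ζ →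
      KeyLattice.IsReduced ω →
      KeyLattice.wordOp α β γ ω (KeyLattice.xPow F (KeyLattice.plus ζ)) =
        KeyLattice.keyPoly α β γ ζ) ∧
    -- `C K_ζ = Z`, hence `K_ζ = (1 / C) Z` if `C ≠ 0`, which holds for generic parameters
    MvPolynomial.C (KeyLattice.normConst α β γ (KeyLattice.muOf ζ)) *
      KeyLattice.keyPoly α β γ ζ = KeyLattice.keyPartitionFn α β γ ζ ∧
    (KeyLattice.normConst α β γ (KeyLattice.muOf ζ) ≠ 0 →
      KeyLattice.keyPoly α β γ ζ =
        MvPolynomial.C (1 / KeyLattice.normConst α β γ (KeyLattice.muOf ζ)) *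
          KeyLattice.keyPartitionFn α β γ ζ) ∧
    (AlgebraicIndependent ℤ ![α, β, γ] →
      KeyLattice.normConst α β γ (KeyLattice.muOf ζ) ≠ 0) ∧
    -- the case in which `μ - ρ` is a partition
    (∀ lam : Fin n → ℕ, Antitone lam →
      (∀ i, lam i + KeyLattice.rho i = KeyLattice.muOf ζ i) →
      (∀ ω : List (Fin (n - 1)), KeyLattice.wordPerm ω = KeyLattice.vPerm ζ →
        KeyLattice.IsReduced ω →
        KeyLattice.wordOp α β γ ω (KeyLattice.xPow F (KeyLattice.knExp lam)) =
          KeyLattice.knPoly α β γ (KeyLattice.vPerm ζ) lam) ∧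
      KeyLattice.keyPoly α β γ ζ =
        (∏ i, MvPolynomial.X i) ^ KeyLattice.plus ζ (Fin.rev 0) *
          KeyLattice.knPoly α β γ (KeyLattice.vPerm ζ) lam ∧
      (KeyLattice.plus ζ (Fin.rev 0) = 0 →
        KeyLattice.keyPoly α β γ ζ =
          KeyLattice.knPoly α β γ (KeyLattice.vPerm ζ) lam)) := by
  open KeyLattice MvPolynomial in
  have hred := isReduced_redWord (vPerm ζ)
  have hperm := wordPerm_redWord (vPerm ζ)
  have hword : ∀ ω : List (Fin (n - 1)), wordPerm ω = vPerm ζ → IsReduced ω →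
      wordOp α β γ ω (xPow F (plus ζ)) = keyPoly α β γ ζ := fun ω h1 h2 =>
    wordOp_eq_of_isReduced α β γ ζ h2 hred (h1.trans hperm.symm)
  have hZ : C (normConst α β γ (muOf ζ)) * keyPoly α β γ ζ = keyPartitionFn α β γ ζ := by
    have := normConst_mul_wordOp α β γ ζ hred
    rwa [hperm] at this
  refine ⟨fun u => isMinSorter_iff, hword, hZ, fun hC => ?_, fun h => normConst_ne_zero h _,
    fun lam hlam h => ?_⟩
  · rw [← hZ, ← mul_assoc, ← C_mul, one_div, inv_mul_cancel₀ hC, C_1, one_mul]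
  · have hkey : ∀ ω : List (Fin (n - 1)), wordOp α β γ ω (xPow F (plus ζ))
        = (∏ i, X i) ^ plus ζ (Fin.rev 0) * wordOp α β γ ω (xPow F (knExp lam)) := fun ω => by
      rw [xPow_plus hlam h, wordOp_mul _ _ _ _ (isSymmetric_prod_X_pow _)]
    have hK : keyPoly α β γ ζ
        = (∏ i, X i) ^ plus ζ (Fin.rev 0) * knPoly α β γ (vPerm ζ) lam := hkey _
    refine ⟨fun ω h1 h2 => ?_, hK, fun h0 => by rw [hK, h0, pow_zero, one_mul]⟩
    -- Independence of the word for `x^d` is inherited from that for `x^{ζ⁺}` by cancelling this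
    -- symmetric monomial.
    have hne : (∏ i, X i : MvPolynomial (Fin n) F) ^ plus ζ (Fin.rev 0) ≠ 0 :=
      pow_ne_zero _ (Finset.prod_ne_zero_iff.2 fun i _ => X_ne_zero i)
    refine mul_left_cancel₀ hne ?_
    rw [← hK, ← hkey, hword ω h1 h2]
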